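/- Let $R$ be a discrete valuation ring, $V=\operatorname{Spec}R$ with closed point $v$ and residue field $k(v)$. Let $X$ be an irreducible affine $V$-scheme, smooth of relative dimension $n\ge 1$ over $V$, and let $Z\subset X$ be a closed subset of pure codimension $1$ that contains no irreducible component of the closed fiber $X_v$. Let $\underline{x}\subset Z_v=Z\cap X_v$ be a finite set of closed points of $X_v$. Assume that $k(v)$ is infinite or that $\underline{x}$ consists of a single point. Then there exist: (a) a localization $\mathcal X=\operatorname{Spec}S^{-1}\Gamma(X,\mathcal O_X)$ of $X$ (for some multiplicative set $S\subset\Gamma(X,\mathcal O_X)$) that contains $\underline{x}$; (b) a finite set $\underline{y}$ of closed points of $\mathbb A^n_v$, with semi-localization $\mathcal A=\operatorname{Spec}\mathcal O_{\mathbb A^n_V,\underline{y}}$ of $\mathbb A^n_V$ at $\underline{y}$; (c) an element $h\in\mathcal O_{\mathbb A^n_V,\underline{y}}$ and an étale $V$-morphism $\tau\colon\mathcal X\to\mathcal A$ with $\tau(\underline{x})=\underline{y}$; such that, with $\mathcal Z=Z\cap\mathcal X$ (the preimage of $Z$ in $\mathcal X$), the set $\tau(\mathcal Z)$ is closed in $\mathcal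 A$, $$\mathcal X-\mathcal Z=\mathcal X_{\tau^*h},\qquad \mathcal A-\tau(\mathcal Z)=\mathcal A_h ,$$ and the square $$\begin{array}{ccc}\mathcal X_{\tau^*h}=\mathcal X-\mathcal Z&\hookrightarrow&\mathcal X\\ \downarrow&&\downarrow{\scriptstyle\tau}\\ \mathcal A_h=\mathcal A-\tau(\mathcal Z)&\hookrightarrow&\mathcal A\end{array}$$ is an elementary distinguished square: it is cartesian, $\tau$ is étale, the lower horizontal map is an open immersion, and $\tau$ induces an isomorphism $\tau^{-1}(\tau(\mathcal Z))=\mathcal Z\to\tau(\mathcal Z)$ of closed subsets with their reduced scheme structures. -/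

import Mathlib

open CategoryTheory Limits TopologicalSpace AlgebraicGeometry

universe u

noncomputable section

namespace GeomPres

/-- `C` is an irreducible component of the closed subset `Z` of a space `T`: a maximal element
among the irreducible closed subsets of `T` that are contained in `Z`. -/
def IsComponentOf {T : Type*} [TopologicalSpace T] (C : IrreducibleCloseds T) (Z : Closeds T) :
    Prop :=
  Maximal (fun D : IrreducibleCloseds T ↦ (D : Set T) ⊆ (Z : Set T)) C

/-- The closed subset `Z` has pure codimension `c`: every irreducible component of `Z` has
codimension `c`, the codimension of an irreducible closed subset being the supremum of the
lengths of chains of irreducible closed subsets starting at it. -/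
def IsPureCodim {T : Type*} [TopologicalSpace T] (Z : Closeds T) (c : ℕ) : Prop :=
  ∀ C : IrreducibleCloseds T, IsComponentOf C Z → Order.coheight C = (c : ℕ∞)

/-- The localization `Spec (S⁻¹ Γ(X, O_X))` of an affine scheme `X` at a multiplicative set `S` of
global functions. -/
def loc (X : Scheme.{u}) (S : Submonoid Γ(X, ⊤)) : Scheme.{u} :=
  Spec (CommRingCat.of (Localization S))

/-- The canonical morphism from a localization of the affine scheme `X` to `X`. -/
def locMap (X : Scheme.{u}) [IsAffine X] (S : Submonoid Γ(X, ⊤)) : loc X S ⟶ X :=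
  Spec.map (CommRingCat.ofHom (algebraMap Γ(X, ⊤) (Localization S))) ≫ X.isoSpec.inv

/-- The global functions on `X` that vanish at no point of `y`. For `X` affine and `y` finite, the
localization of `X` at this multiplicative set is `Spec O_{X, y}`. -/
def nonvanishing (X : Scheme.{u}) (y : Set X) : Submonoid Γ(X, ⊤) where
  carrier := {s | ∀ p ∈ y, p ∈ X.basicOpen s}
  one_mem' := fun p _ ↦ by simp
  mul_mem' := fun {s t} hs ht p hp ↦ by
    rw [Scheme.basicOpen_mul]
    exact ⟨hs p hp, ht p hp⟩

/-- The localization `Spec O_{X, y}` of the affine scheme `X` at the finite set of points `y`. -/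
abbrev locAt (X : Scheme.{u}) (y : Set X) : Scheme.{u} :=
  loc X (nonvanishing X y)

/-- The canonical morphism `Spec O_{X, y} ⟶ X`. -/
abbrev locAtMap (X : Scheme.{u}) [IsAffine X] (y : Set X) : locAt X y ⟶ X :=
  locMap X (nonvanishing X y)

/-- The affine space of dimension `n` over `Spec R`. -/
abbrev affSpace (R : Type u) [CommRing R] (n : ℕ) : Scheme.{u} :=
  𝔸(ULift.{u} (Fin n); Spec (CommRingCat.of R))

/-- The structure morphism of affine space. -/
abbrev affSpaceMap (R : Type u) [CommRing R] (n : ℕ) :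
    affSpace R n ⟶ Spec (CommRingCat.of R) :=
  𝔸(ULift.{u} (Fin n); Spec (CommRingCat.of R)) ↘ Spec (CommRingCat.of R)

/-- The closed subset `T` of `A` with its reduced induced closed subscheme structure. -/
def red {A : Scheme.{u}} (T : Closeds A) : Scheme.{u} :=
  (Scheme.IdealSheafData.vanishingIdeal T).subscheme

/-- The inclusion of `T`, with its reduced structure, into `A`. -/
def redι {A : Scheme.{u}} (T : Closeds A) : red T ⟶ A :=
  (Scheme.IdealSheafData.vanishingIdeal T).subschemeι

/-- Elementary distinguished squares: cartesian squares
```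
  W --i--> Y
  |        |
  t        p
  v        v
  U --j--> A
```
with `p` étale and `j` an open immersion, such that `p` induces an isomorphism from
`p⁻¹(A - U)` onto `A - U`, both with their reduced structures. (The inclusion of `A - U` is a
monomorphism, so the isomorphism `e` is the only morphism compatible with `p`.) -/
structure IsElementaryDistinguishedSquare {W Y U A : Scheme.{u}}
    (i : W ⟶ Y) (t : W ⟶ U) (p : Y ⟶ A) (j : U ⟶ A) : Prop where
  isPullback : IsPullback i t p j
  isOpenImmersion : IsOpenImmersion j
  etale : Etale p
  iso_complement : ∀ T : Closeds A, (T : Set A) = (Set.range j)ᶜ →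
    ∃ e : red (T.preimage p.continuous) ≅ red T, e.hom ≫ redι T = redι (T.preimage p.continuous) ≫ p

end GeomPres

end

section PrimitiveElement

open Polynomial IntermediateField

/-- If `F` is infinite, `α` is algebraic and `β` is separable over `F`, then `F⟮α, β⟯` is generated
by a single element. -/
theorem IntermediateField.exists_adjoin_pair_eq_adjoin_simple {F E : Type*} [Field F] [Infinite F]
    [Field E] [Algebra F E] (α β : E) (hα : IsIntegral F α) (hβs : IsSeparable F β) :
    ∃ γ : E, F⟮α, β⟯ = F⟮γ⟯ := by
  have hβ : IsIntegral F β := hβs.isIntegral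
  let f := minpoly F α
  let g := minpoly F β
  let ιFE := algebraMap F E
  let ιEE' := algebraMap E (SplittingField (g.map ιFE))
  obtain ⟨c, hc⟩ := Field.primitive_element_inf_aux_exists_c
    (ιEE'.comp ιFE) (ιEE' α) (ιEE' β) f g
  let γ := α + c • β
  suffices β_in_Fγ : β ∈ F⟮γ⟯ by
    use γ
    apply le_antisymm
    · rw [adjoin_le_iff]
      have α_in_Fγ : α ∈ F⟮γ⟯ := by
        rw [← add_sub_cancel_right α (c • β)]
        exact F⟮γ⟯.sub_mem (mem_adjoin_simple_self F γ) (F⟮γ⟯.toSubalgebra.smul_mem β_in_Fγ c)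
      rintro x (rfl | rfl) <;> assumption
    · rw [adjoin_simple_le_iff]
      have α_in_Fαβ : α ∈ F⟮α, β⟯ := subset_adjoin F {α, β} (Set.mem_insert α {β})
      have β_in_Fαβ : β ∈ F⟮α, β⟯ := subset_adjoin F {α, β} (Set.mem_insert_of_mem α rfl)
      exact F⟮α, β⟯.add_mem α_in_Fαβ (F⟮α, β⟯.smul_mem β_in_Fαβ)
  classical
  let p := EuclideanDomain.gcd ((f.map (algebraMap F F⟮γ⟯)).comp
    (C (AdjoinSimple.gen F γ) - (C ↑c : F⟮γ⟯[X]) * X)) (g.map (algebraMap F F⟮γ⟯))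
  let h := EuclideanDomain.gcd ((f.map ιFE).comp (C γ - C (ιFE c) * X)) (g.map ιFE)
  have map_g_ne_zero : g.map ιFE ≠ 0 := map_ne_zero (minpoly.ne_zero hβ)
  have h_ne_zero : h ≠ 0 :=
    mt EuclideanDomain.gcd_eq_zero_iff.mp (not_and.mpr fun _ => map_g_ne_zero)
  suffices p_linear : p.map (algebraMap F⟮γ⟯ E) = C h.leadingCoeff * (X - C β) by
    have finale : β = algebraMap F⟮γ⟯ E (-p.coeff 0 / p.coeff 1) := by
      simp [map_div₀, map_neg, ← coeff_map, ← coeff_map, p_linear,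
        mul_sub, coeff_C, mul_div_cancel_left₀ β (mt leadingCoeff_eq_zero.mp h_ne_zero)]
    rw [finale]
    exact Subtype.mem (-p.coeff 0 / p.coeff 1)
  have h_sep : h.Separable := separable_gcd_right _ (.map hβs)
  have h_root : h.eval β = 0 := by
    apply eval_gcd_eq_zero
    · rw [eval_comp, eval_sub, eval_mul, eval_C, eval_C, eval_X, eval_map_algebraMap, ←
        Algebra.smul_def, add_sub_cancel_right, minpoly.aeval]
    · rw [eval_map_algebraMap, minpoly.aeval]
  have h_splits : Splits (h.map ιEE') := by
    rw [← Polynomial.gcd_map]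
    exact (SplittingField.splits _).of_dvd (map_ne_zero map_g_ne_zero)
      (EuclideanDomain.gcd_dvd_right _ _)
  have h_roots : ∀ x ∈ (h.map ιEE').roots, x = ιEE' β := by
    intro x hx
    rw [mem_roots_map h_ne_zero] at hx
    specialize hc (ιEE' γ - ιEE' (ιFE c) * x) (by
      have f_root := root_left_of_root_gcd hx
      rw [eval₂_comp, eval₂_sub, eval₂_mul, eval₂_C, eval₂_C, eval₂_X, eval₂_map] at f_root
      exact (mem_roots_map (minpoly.ne_zero hα)).mpr f_root)
    specialize hc x (by
      rw [mem_roots_map (minpoly.ne_zero hβ), ← eval₂_map]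
      exact root_right_of_root_gcd hx)
    by_contra a
    apply hc
    apply (div_eq_iff (sub_ne_zero.mpr a)).mpr
    simp only [γ, Algebra.smul_def, map_add, map_mul, RingHom.comp_apply]
    ring
  rw [← eq_X_sub_C_of_separable_of_root_eq h_sep h_root h_splits h_roots]
  trans EuclideanDomain.gcd (?_ : E[X]) (?_ : E[X])
  · dsimp only [γ]
    convert! (gcd_map (algebraMap F⟮γ⟯ E)).symm
  · simp only [map_comp, Polynomial.map_map, ← IsScalarTower.algebraMap_eq, Polynomial.map_sub,
      map_C, AdjoinSimple.algebraMap_gen, Polynomial.map_mul, map_X]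
    congr

/-- A finite extension that is separable over a simple subextension is simple. -/
theorem IntermediateField.exists_adjoin_simple_eq_top_of_isSeparable {F E : Type*} [Field F]
    [Field E] [Algebra F E] [FiniteDimensional F E] (a : E) [Algebra.IsSeparable F⟮a⟯ E] :
    ∃ γ : E, F⟮γ⟯ = ⊤ := by
  rcases finite_or_infinite F with _ | _
  · exact Field.exists_primitive_element_of_finite_bot F E
  obtain ⟨β, hβ⟩ := Field.exists_primitive_element F (separableClosure F E)
  have hβL : F⟮(β : E)⟯ = separableClosure F E := by
    have := congrArg IntermediateField.lift hβ
    rwa [lift_adjoin_simple, lift_top] at this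
  obtain ⟨γ, hγ⟩ := exists_adjoin_pair_eq_adjoin_simple (F := F) a (β : E)
    (Algebra.IsIntegral.isIntegral a) ((mem_separableClosure_iff).mp β.2)
  refine ⟨γ, ?_⟩
  rw [← hγ, eq_top_iff]
  have h1 : F⟮a⟯ ≤ F⟮a, (β : E)⟯ := by
    rw [adjoin_simple_le_iff]
    exact subset_adjoin F _ (by simp)
  have h2 : separableClosure F E ≤ F⟮a, (β : E)⟯ := by
    refine hβL.symm.le.trans (adjoin_simple_le_iff.mpr (subset_adjoin F _ (by simp)))
  let : Algebra F⟮a⟯ F⟮a, (β : E)⟯ := (inclusion h1).toRingHom.toAlgebra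
  let : Algebra (separableClosure F E) F⟮a, (β : E)⟯ := (inclusion h2).toRingHom.toAlgebra
  have : IsScalarTower F⟮a⟯ F⟮a, (β : E)⟯ E := .of_algebraMap_eq' rfl
  have : IsScalarTower (separableClosure F E) F⟮a, (β : E)⟯ E := .of_algebraMap_eq' rfl
  have : Algebra.IsSeparable F⟮a, (β : E)⟯ E :=
    Algebra.isSeparable_tower_top_of_isSeparable F⟮a⟯ F⟮a, (β : E)⟯ E
  have : IsPurelyInseparable (separableClosure F E) E := separableClosure.isPurelyInseparable F E
  have : IsPurelyInseparable F⟮a, (β : E)⟯ E :=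
    IsPurelyInseparable.tower_top (separableClosure F E) F⟮a, (β : E)⟯ E
  intro x _
  obtain ⟨y, rfl⟩ := IsPurelyInseparable.surjective_algebraMap_of_isSeparable F⟮a, (β : E)⟯ E x
  exact y.2

/-- If a finite extension is separable over the subextension generated by `n + 1` elements, then
it is generated by `n + 1` elements. -/
theorem exists_adjoin_range_eq_top_of_isSeparable {k K : Type*} [Field k] [Field K] [Algebra k K]
    [FiniteDimensional k K] {n : ℕ} (a : Fin (n + 1) → K)
    (ha : Algebra.IsSeparable (IntermediateField.adjoin k (Set.range a)) K) :
    ∃ c : Fin (n + 1) → K, Algebra.adjoin k (Set.range c) = ⊤ := by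
  let F := IntermediateField.adjoin k (Set.range (Fin.tail a))
  have hrange : Set.range a = Set.range (Fin.tail a) ∪ {a 0} := by
    rw [← Fin.cons_self_tail a, Fin.range_cons]
    simp
  have hle : IntermediateField.adjoin k (Set.range a) ≤ (F⟮a 0⟯).restrictScalars k := by
    rw [IntermediateField.adjoin_le_iff, hrange]
    rintro x (⟨i, rfl⟩ | rfl)
    · exact (F⟮a 0⟯).algebraMap_mem ⟨_, IntermediateField.subset_adjoin k _ ⟨i, rfl⟩⟩
    · exact mem_adjoin_simple_self F (a 0)
  let : Algebra (IntermediateField.adjoin k (Set.range a)) F⟮a 0⟯ :=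
    (inclusion hle).toRingHom.toAlgebra
  have : IsScalarTower (IntermediateField.adjoin k (Set.range a)) F⟮a 0⟯ K := .of_algebraMap_eq' rfl
  have : Algebra.IsSeparable F⟮a 0⟯ K :=
    Algebra.isSeparable_tower_top_of_isSeparable (IntermediateField.adjoin k (Set.range a)) F⟮a 0⟯ K
  have : FiniteDimensional F K := FiniteDimensional.right k F K
  obtain ⟨γ, hγ⟩ := IntermediateField.exists_adjoin_simple_eq_top_of_isSeparable (F := F) (a 0)
  refine ⟨Fin.cons γ (Fin.tail a), ?_⟩
  have halg : ∀ x ∈ Set.range (Fin.cons γ (Fin.tail a) : Fin (n + 1) → K), IsAlgebraic k x :=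
    fun x _ ↦ Algebra.IsAlgebraic.isAlgebraic x
  rw [← IntermediateField.adjoin_toSubalgebra_of_isAlgebraic halg, Fin.range_cons, Set.insert_eq,
    Set.union_comm, ← IntermediateField.adjoin_adjoin_left, hγ]
  simp

end PrimitiveElement

section LinearAlgebra

/-- In a space of dimension at most `n`, a family of `n` vectors that spans modulo a subspace `U`
can be moved by vectors of `U` to a spanning family. -/
theorem exists_forall_mem_span_range_add_eq_top {K V : Type*} [Field K] [AddCommGroup V]
    [Module K V] [FiniteDimensional K V] {n : ℕ} (hn : Module.finrank K V ≤ n) (U : Submodule K V)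
    (v : Fin n → V) (hU : U ⊔ Submodule.span K (Set.range v) = ⊤) :
    ∃ u : Fin n → V, (∀ i, u i ∈ U) ∧ Submodule.span K (Set.range (u + v)) = ⊤ := by
  let φ : (Fin n → K) →ₗ[K] V := Fintype.linearCombination K v
  have hφ : LinearMap.range φ = Submodule.span K (Set.range v) :=
    Fintype.range_linearCombination K v
  obtain ⟨U', hU'le, hU'⟩ : ∃ U' ≤ U, IsCompl (LinearMap.range φ) U' := by
    obtain ⟨W, hW⟩ := Submodule.exists_isCompl ((LinearMap.range φ).comap U.subtype)
    refine ⟨W.map U.subtype, Submodule.map_subtype_le _ _, ?_, ?_⟩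
    · rw [Submodule.disjoint_def]
      rintro x hx ⟨w, hw, rfl⟩
      have : w ∈ (LinearMap.range φ).comap U.subtype ⊓ W := ⟨hx, hw⟩
      rw [hW.inf_eq_bot] at this
      simp [(Submodule.mem_bot K).mp this]
    · rw [codisjoint_iff, eq_top_iff, ← hU, ← hφ]
      refine sup_le ?_ le_sup_left
      intro x hx
      have : (⟨x, hx⟩ : U) ∈ (LinearMap.range φ).comap U.subtype ⊔ W := by
        rw [hW.sup_eq_top]; trivial
      obtain ⟨y, hy, z, hz, hyz⟩ := Submodule.mem_sup.mp this
      rw [show x = y.1 + z.1 from congrArg Subtype.val hyz.symm]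
      exact Submodule.add_mem_sup hy ⟨z, hz, rfl⟩
  have hdim : Module.finrank K U' ≤ Module.finrank K (LinearMap.ker φ) := by
    have h1 := Submodule.finrank_add_eq_of_isCompl hU'
    have h2 := LinearMap.finrank_range_add_finrank_ker φ
    simp only [Module.finrank_fin_fun] at h2
    omega
  obtain ⟨N, hN⟩ := Submodule.exists_isCompl (LinearMap.ker φ)
  obtain ⟨g, hg⟩ : ∃ g : LinearMap.ker φ →ₗ[K] U', Function.Surjective g := by
    obtain ⟨i, hi⟩ := finrank_le_iff_exists_linearMap.mp hdim
    obtain ⟨g, hg⟩ := LinearMap.exists_leftInverse_of_injective i (LinearMap.ker_eq_bot.mpr hi)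
    exact ⟨g, fun x ↦ ⟨i x, LinearMap.congr_fun hg x⟩⟩
  let ψ : (Fin n → K) →ₗ[K] V :=
    U'.subtype ∘ₗ g ∘ₗ Submodule.projectionOnto _ _ hN
  refine ⟨fun i ↦ ψ (Pi.single i 1), fun i ↦ hU'le (Subtype.mem _), ?_⟩
  have key : Fintype.linearCombination K ((fun i ↦ ψ (Pi.single i 1)) + v) = ψ + φ := by
    refine LinearMap.pi_ext' fun i ↦ LinearMap.ext_ring ?_
    simp [φ, Fintype.linearCombination_apply_single]
  rw [← Fintype.range_linearCombination, key, eq_top_iff, ← hU'.sup_eq_top]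
  have hU'r : U' ≤ LinearMap.range (ψ + φ) := by
    intro x hx
    obtain ⟨y, hy⟩ := hg ⟨x, hx⟩
    refine ⟨y, ?_⟩
    simp [ψ, hy, Submodule.projectionOnto_apply_left]
  refine sup_le ?_ hU'r
  rintro _ ⟨y, rfl⟩
  have h1 : (ψ + φ) y - ψ y ∈ LinearMap.range (ψ + φ) :=
    sub_mem ⟨y, rfl⟩ (hU'r (Subtype.mem _))
  simpa using h1

end LinearAlgebra

section Kaehler

open KaehlerDifferential TensorProduct

theorem Submodule.exists_sub_one_mem_forall_smul_mem_of_sup_smul_eq_top {B M : Type*} [CommRing B]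
    [AddCommGroup M] [Module B M] [Module.Finite B M] (m : Ideal B) (N : Submodule B M)
    (h : N ⊔ m • (⊤ : Submodule B M) = ⊤) : ∃ s : B, s - 1 ∈ m ∧ ∀ x : M, s • x ∈ N := by
  obtain ⟨r, hr, hr'⟩ := Submodule.exists_sub_one_mem_and_smul_eq_zero_of_fg_of_le_smul m
    (⊤ : Submodule B (M ⧸ N)) Module.Finite.fg_top (by
      have := congrArg (Submodule.map N.mkQ) h
      rw [Submodule.map_sup, Submodule.map_smul'', Submodule.map_top, Submodule.range_mkQ] at this
      simpa using this.ge)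
  refine ⟨r, hr, fun x ↦ ?_⟩
  have := hr' (N.mkQ x) trivial
  rwa [← map_smul, Submodule.mkQ_apply, Submodule.Quotient.mk_eq_zero] at this

theorem Submodule.eq_top_of_forall_exists_smul_mem {B M : Type*} [CommRing B] [AddCommGroup M]
    [Module B M] (m : Ideal B) [m.IsMaximal] (N : Submodule B M) (hN : m • ⊤ ≤ N)
    (h : ∀ x, ∃ s ∉ m, s • x ∈ N) : N = ⊤ := by
  refine eq_top_iff.mpr fun x _ ↦ ?_
  obtain ⟨s, hs, hsx⟩ := h x
  obtain ⟨a, b, hb, hab⟩ := Ideal.IsMaximal.exists_inv ‹_› hs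
  have : x = a • s • x + b • x := by rw [smul_smul, ← add_smul, hab, one_smul]
  rw [this]
  exact N.add_mem (N.smul_mem _ hsx) (hN (Submodule.smul_mem_smul hb trivial))

theorem IsLocalizedModule.exists_span_range_sup_smul_eq_top {B M L M' : Type*} [CommRing B]
    [AddCommGroup M] [Module B M] (m : Ideal B) [m.IsMaximal] [CommRing L] [Algebra B L]
    [IsLocalization.AtPrime L m] [AddCommGroup M'] [Module B M'] [Module L M'] [IsScalarTower B L M']
    (f : M →ₗ[B] M') [IsLocalizedModule m.primeCompl f] {n : ℕ} (w : Fin n → M')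
    (hw : Submodule.span L (Set.range w) = ⊤) :
    ∃ v : Fin n → M, Submodule.span B (Set.range v) ⊔ m • (⊤ : Submodule B M) = ⊤ := by
  choose v hv using fun i ↦ IsLocalizedModule.surj m.primeCompl f (w i)
  refine ⟨fun i ↦ (v i).1, Submodule.eq_top_of_forall_exists_smul_mem m _ le_sup_right fun x ↦ ?_⟩
  have key : ∀ y ∈ Submodule.span L (Set.range w), ∃ s ∉ m,
      s • y ∈ (Submodule.span B (Set.range fun i ↦ (v i).1)).map f := by
    intro y hy
    induction hy using Submodule.span_induction with
    | mem y hy =>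
      obtain ⟨i, rfl⟩ := hy
      refine ⟨(v i).2, (v i).2.2, (v i).1, Submodule.subset_span ⟨i, rfl⟩, (hv i).symm⟩
    | zero => exact ⟨1, Ideal.one_notMem m, by simp⟩
    | add y z _ _ hy hz =>
      obtain ⟨s, hs, hs'⟩ := hy
      obtain ⟨t, ht, ht'⟩ := hz
      refine ⟨s * t, Ideal.IsPrime.mul_notMem inferInstance hs ht, ?_⟩
      rw [smul_add, mul_comm s t, mul_smul, mul_comm t s, mul_smul]
      exact add_mem (Submodule.smul_mem _ _ hs') (Submodule.smul_mem _ _ ht')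
    | smul a y _ hy =>
      obtain ⟨s, hs, hs'⟩ := hy
      obtain ⟨⟨b, t⟩, hbt⟩ := IsLocalization.surj m.primeCompl a
      refine ⟨t * s, Ideal.IsPrime.mul_notMem inferInstance t.2 hs, ?_⟩
      have : ((t : B) * s) • a • y = b • s • y := by
        rw [mul_smul, smul_comm s a y, ← algebraMap_smul L (t : B) (a • s • y), smul_smul,
          mul_comm, hbt, algebraMap_smul]
      rw [this]
      exact Submodule.smul_mem _ _ hs'
  obtain ⟨s, hs, z, hz, hzx⟩ := key (f x) (hw ▸ trivial)
  rw [← map_smul] at hzx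
  obtain ⟨c, hc⟩ := (IsLocalizedModule.eq_iff_exists m.primeCompl f).mp hzx
  refine ⟨c * s, Ideal.IsPrime.mul_notMem inferInstance c.2 hs, Submodule.mem_sup_left ?_⟩
  rw [mul_smul]
  change (c : B) • z = (c : B) • s • x at hc
  rw [← hc]
  exact Submodule.smul_mem _ _ hz

variable {R B : Type u} [CommRing R] [CommRing B] [Algebra R B]

theorem kaehlerDifferential_localization_free_and_finrank_eq {n : ℕ} (m : Ideal B) [m.IsPrime] {t : B}
    (ht : t ∉ m) [Algebra.IsStandardSmoothOfRelativeDimension n R (Localization.Away t)] :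
    Module.Free (Localization.AtPrime m) Ω[Localization.AtPrime m⁄R] ∧
      Module.Finite (Localization.AtPrime m) Ω[Localization.AtPrime m⁄R] ∧
      Module.finrank (Localization.AtPrime m) Ω[Localization.AtPrime m⁄R] = n := by
  have hle : Submonoid.powers t ≤ m.primeCompl := by
    rw [Submonoid.powers_le]; exact ht
  let : Algebra (Localization.Away t) (Localization.AtPrime m) :=
    IsLocalization.localizationAlgebraOfSubmonoidLe _ _ _ _ hle
  have : IsScalarTower B (Localization.Away t) (Localization.AtPrime m) :=
    IsLocalization.localization_isScalarTower_of_submonoid_le _ _ _ _ hle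
  have : IsScalarTower R (Localization.Away t) (Localization.AtPrime m) := .to₁₃₄ R B _ _
  have : IsLocalization (m.primeCompl.map (algebraMap B (Localization.Away t)))
      (Localization.AtPrime m) :=
    IsLocalization.isLocalization_of_submonoid_le _ _ _ _ hle
  have : Algebra.FormallyEtale (Localization.Away t) (Localization.AtPrime m) :=
    .of_isLocalization (m.primeCompl.map (algebraMap B (Localization.Away t)))
  have : Algebra.IsStandardSmooth R (Localization.Away t) :=
    Algebra.IsStandardSmoothOfRelativeDimension.isStandardSmooth n
  have : Nontrivial (Localization.Away t) :=
    (algebraMap (Localization.Away t) (Localization.AtPrime m)).domain_nontrivial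
  let e := tensorKaehlerEquivOfFormallyEtale R (Localization.Away t) (Localization.AtPrime m)
  refine ⟨.of_equiv e, .equiv e, ?_⟩
  rw [← e.finrank_eq, Module.finrank_baseChange]
  simp [Module.finrank, Algebra.IsStandardSmoothOfRelativeDimension.rank_kaehlerDifferential n]

theorem exists_kaehlerDifferential_span_sup_smul_eq_top {n : ℕ} (m : Ideal B) [m.IsMaximal] {t : B}
    (ht : t ∉ m) [Algebra.IsStandardSmoothOfRelativeDimension n R (Localization.Away t)] :
    ∃ v : Fin n → Ω[B⁄R], Submodule.span B (Set.range v) ⊔ m • ⊤ = ⊤ := by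
  obtain ⟨h1, h2, h3⟩ := kaehlerDifferential_localization_free_and_finrank_eq (R := R) (n := n) m ht
  let b := Module.finBasisOfFinrankEq (Localization.AtPrime m) Ω[Localization.AtPrime m⁄R] h3
  exact IsLocalizedModule.exists_span_range_sup_smul_eq_top (L := Localization.AtPrime m) m
    (map R R B (Localization.AtPrime m)) b b.span_eq

theorem isEtaleAt_of_span_sup_smul_eq_top {n : ℕ} [Algebra.Smooth R B]
    [Algebra (MvPolynomial (Fin n) R) B]
    [IsScalarTower R (MvPolynomial (Fin n) R) B] (m : Ideal B) [m.IsPrime] {t : B}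
    (ht : t ∉ m) [Algebra.IsStandardSmoothOfRelativeDimension n R (Localization.Away t)]
    (h : Submodule.span B
      (Set.range fun i ↦ D R B (algebraMap (MvPolynomial (Fin n) R) B (.X i))) ⊔ m • ⊤ = ⊤) :
    Algebra.IsEtaleAt (MvPolynomial (Fin n) R) m := by
  obtain ⟨h1, h2, h3⟩ := kaehlerDifferential_localization_free_and_finrank_eq (R := R) (n := n) m ht
  let P := MvPolynomial (Fin n) R
  let L := Localization.AtPrime m
  have : IsScalarTower R P L := .to₁₂₄ R P B L
  have hspan : Submodule.span L (Set.range fun i ↦ D R L (algebraMap P L (.X i))) = ⊤ := by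
    obtain ⟨s, hs1, hs⟩ := Submodule.exists_sub_one_mem_forall_smul_mem_of_sup_smul_eq_top m _ h
    have hsm : s ∉ m := fun hsm ↦ Ideal.one_notMem m (by simpa using sub_mem hsm hs1)
    have hu : IsUnit (algebraMap B L s) := IsLocalization.map_units L (⟨s, hsm⟩ : m.primeCompl)
    rw [eq_top_iff, ← span_range_map_derivation_of_isLocalization R B L m.primeCompl,
      Submodule.span_le]
    rintro _ ⟨b, rfl⟩
    have hsb := hs (D R B b)
    have h4 : map R R B L (s • D R B b) ∈
        Submodule.span L (Set.range fun i ↦ D R L (algebraMap P L (.X i))) := by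
      generalize s • D R B b = z at hsb
      induction hsb using Submodule.span_induction with
      | mem x hx =>
        obtain ⟨i, rfl⟩ := hx
        rw [map_D, ← IsScalarTower.algebraMap_apply]
        exact Submodule.subset_span ⟨i, rfl⟩
      | zero => simp
      | add x y _ _ hx hy => rw [map_add]; exact add_mem hx hy
      | smul a x _ hx =>
        rw [map_smul, ← algebraMap_smul L]
        exact Submodule.smul_mem _ _ hx
    rw [map_smul, ← algebraMap_smul L] at h4
    exact (Submodule.smul_mem_iff_of_isUnit _ hu).mp h4
  let φ := mapBaseChange R P L
  let b := (mvPolynomialBasis R (Fin n)).baseChange L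
  have hφb : φ ∘ b = fun i ↦ D R L (algebraMap P L (.X i)) := by
    ext i
    simp [φ, b, mapBaseChange_tmul, P]
  have hbij : Function.Bijective φ :=
    LinearMap.bijective_of_linearIndependent_of_span_eq_top b.span_eq
      (by rw [hφb]
          exact linearIndependent_of_top_le_span_of_card_eq_finrank hspan.ge (by simp [h3, L]))
      (by rw [hφb]; exact hspan)
  have : Algebra.FormallySmooth R L := .comp R B L
  have hH : Subsingleton (Algebra.H1Cotangent R L) :=
    ((Algebra.formallySmooth_iff R L).mp inferInstance).2
  refine (Algebra.formallyEtale_iff P L).mpr ⟨⟨fun x y ↦ ?_⟩, ⟨fun x y ↦ ?_⟩⟩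
  · suffices ∀ x : Ω[L⁄P], x = 0 by rw [this x, this y]
    intro x
    obtain ⟨y, rfl⟩ := map_surjective R P L x
    exact (exact_mapBaseChange_map R P L y).mpr (hbij.2 y)
  · suffices ∀ x : Algebra.H1Cotangent P L, x = 0 by rw [this x, this y]
    intro x
    have h5 : Algebra.H1Cotangent.δ R P L x = 0 := by
      apply hbij.1
      rw [map_zero]
      exact (Algebra.H1Cotangent.exact_δ_mapBaseChange R P L _).mpr ⟨x, rfl⟩
    obtain ⟨y, rfl⟩ := (Algebra.H1Cotangent.exact_map_δ R P L x).mp h5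
    rw [Subsingleton.elim y 0, map_zero]

end Kaehler

section Coordinates

open KaehlerDifferential

attribute [local instance] Ideal.Quotient.field

variable {R B : Type u} [CommRing R] [CommRing B] [Algebra R B]

theorem KaehlerDifferential.D_mem_smul_top_of_mem_sq (m : Ideal B) {b : B} (hb : b ∈ m ^ 2) :
    D R B b ∈ m • (⊤ : Submodule B Ω[B⁄R]) := by
  rw [pow_two] at hb
  induction hb using Submodule.mul_induction_on' with
  | mem_mul_mem x hx y hy =>
    rw [Derivation.leibniz]
    exact add_mem (Submodule.smul_mem_smul hx trivial) (Submodule.smul_mem_smul hy trivial)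
  | add x _ y _ hx hy => rw [map_add]; exact add_mem hx hy

theorem KaehlerDifferential.span_sup_smul_eq_top_of_sub_mem_sq {ι : Type*} (m : Ideal B)
    {a b : ι → B} (hab : ∀ i, b i - a i ∈ m ^ 2)
    (ha : Submodule.span B (Set.range fun i ↦ D R B (a i)) ⊔ m • ⊤ = ⊤) :
    Submodule.span B (Set.range fun i ↦ D R B (b i)) ⊔ m • ⊤ = ⊤ := by
  refine eq_top_iff.mpr (ha.ge.trans (sup_le ?_ le_sup_right))
  rw [Submodule.span_le]
  rintro _ ⟨i, rfl⟩
  have : D R B (a i) = D R B (b i) - D R B (b i - a i) := by rw [map_sub, sub_sub_cancel]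
  simp only [SetLike.mem_coe]
  rw [this]
  exact sub_mem (Submodule.mem_sup_left (Submodule.subset_span ⟨i, rfl⟩))
    (Submodule.mem_sup_right (D_mem_smul_top_of_mem_sq m (hab i)))

theorem KaehlerDifferential.D_aeval_mem_span {ι : Type*} (a : ι → B) (p : MvPolynomial ι R) :
    D R B (MvPolynomial.aeval a p) ∈ Submodule.span B (Set.range fun i ↦ D R B (a i)) := by
  induction p using MvPolynomial.induction_on with
  | C r => simp
  | add p q hp hq => rw [map_add, map_add]; exact add_mem hp hq
  | mul_X p i hp =>
    rw [map_mul, Derivation.leibniz, MvPolynomial.aeval_X]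
    exact add_mem (Submodule.smul_mem _ _ (Submodule.subset_span ⟨i, rfl⟩))
      (Submodule.smul_mem _ _ hp)

/-- A module generated by the differentials modulo `m` is generated, modulo `m`, by as many
differentials of functions as by arbitrary elements. -/
theorem KaehlerDifferential.exists_span_D_sup_smul_eq_top (m : Ideal B) [m.IsMaximal] {n : ℕ}
    (v : Fin n → Ω[B⁄R]) (hv : Submodule.span B (Set.range v) ⊔ m • ⊤ = ⊤) :
    FiniteDimensional (B ⧸ m) (Ω[B⁄R] ⧸ m • (⊤ : Submodule B Ω[B⁄R])) ∧
    Module.finrank (B ⧸ m) (Ω[B⁄R] ⧸ m • (⊤ : Submodule B Ω[B⁄R])) ≤ n ∧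
    ∃ b : Fin n → B, Submodule.span B (Set.range fun i ↦ D R B (b i)) ⊔ m • ⊤ = ⊤ := by
  classical
  let V := Ω[B⁄R] ⧸ m • (⊤ : Submodule B Ω[B⁄R])
  let q : Ω[B⁄R] →ₗ[B] V := Submodule.mkQ _
  have hq : Function.Surjective q := Submodule.mkQ_surjective _
  have hspan : ∀ s : Set Ω[B⁄R], Submodule.span B s ⊔ m • ⊤ = ⊤ ↔
      Submodule.span (B ⧸ m) (q '' s) = ⊤ := by
    intro s
    rw [← Submodule.restrictScalars_eq_top_iff B (B ⧸ m), Submodule.restrictScalars_span B (B ⧸ m)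
      Ideal.Quotient.mk_surjective, ← Submodule.map_span]
    rw [Submodule.map_mkQ_eq_top, sup_comm]
  rw [hspan, ← Set.range_comp] at hv
  have hfin : FiniteDimensional (B ⧸ m) V := ⟨⟨(Set.finite_range (q ∘ v)).toFinset, by
    rw [Set.Finite.coe_toFinset, hv]⟩⟩
  have hrank : Module.finrank (B ⧸ m) V ≤ n := by
    have := finrank_range_le_card (R := B ⧸ m) (q ∘ v)
    rw [Set.finrank, hv, finrank_top] at this
    simpa using this
  refine ⟨hfin, hrank, ?_⟩
  obtain ⟨s, hs, hs', hli⟩ := exists_linearIndependent (B ⧸ m) (q '' (Set.range (D R B)))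
  rw [(hspan _).mp (by rw [span_range_derivation, top_sup_eq])] at hs'
  have hsf : s.Finite := Set.finite_coe_iff.mp hli.finite
  have : Fintype s := hsf.fintype
  have hcard : Fintype.card s ≤ n := hli.fintype_card_le_finrank.trans hrank
  have hsb : ∀ x : s, ∃ b, q (D R B b) = x := by
    rintro ⟨x, hx⟩
    obtain ⟨_, ⟨b, rfl⟩, rfl⟩ := hs hx
    exact ⟨b, rfl⟩
  choose c hc using hsb
  let e := Fintype.equivFin s
  refine ⟨fun i ↦ if h : (i : ℕ) < Fintype.card s then c (e.symm ⟨i, h⟩) else 0, ?_⟩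
  rw [hspan, ← Set.range_comp, eq_top_iff, ← hs', Submodule.span_le]
  intro x hx
  refine Submodule.subset_span ⟨⟨e ⟨x, hx⟩, (e ⟨x, hx⟩).2.trans_le hcard⟩, ?_⟩
  simp only [Function.comp_apply]
  rw [dif_pos (e ⟨x, hx⟩).2]
  simp [hc]

/-- If `n` differentials generate `Ω[B⁄R]` modulo `m`, then `B ⧸ m` is separable over the field
generated by the corresponding functions. -/
theorem isSeparable_adjoin_of_span_sup_smul_eq_top {k : Type u} [Field k] [Algebra R k]
    (m : Ideal B) [m.IsMaximal]
    [Algebra k (B ⧸ m)] [IsScalarTower R k (B ⧸ m)] [FiniteDimensional k (B ⧸ m)]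
    {ι : Type*} (b : ι → B)
    (hb : Submodule.span B (Set.range fun i ↦ D R B (b i)) ⊔ m • ⊤ = ⊤) :
    Algebra.IsSeparable
      (IntermediateField.adjoin k (Set.range fun i ↦ (Ideal.Quotient.mk m (b i)))) (B ⧸ m) := by
  set F := IntermediateField.adjoin k (Set.range fun i ↦ (Ideal.Quotient.mk m (b i)))
  have : IsScalarTower R F (B ⧸ m) := .to₁₃₄ R k F (B ⧸ m)
  have : FiniteDimensional F (B ⧸ m) := FiniteDimensional.right k F (B ⧸ m)
  rw [← Algebra.FormallyUnramified.iff_isSeparable, Algebra.formallyUnramified_iff]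
  have hzero : map R F B (B ⧸ m) = 0 := by
    rw [← LinearMap.ker_eq_top, eq_top_iff, ← hb]
    refine sup_le (Submodule.span_le.mpr ?_) (Submodule.smul_le.mpr fun x hx y _ ↦ ?_)
    · rintro _ ⟨i, rfl⟩
      rw [SetLike.mem_coe, LinearMap.mem_ker, map_D]
      exact (D F (B ⧸ m)).map_algebraMap
        ⟨_, IntermediateField.subset_adjoin k _ (Set.mem_range_self i)⟩
    · rw [LinearMap.mem_ker, map_smul, ← algebraMap_smul (B ⧸ m),
        Ideal.Quotient.algebraMap_eq, Ideal.Quotient.eq_zero_iff_mem.mpr hx, zero_smul]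
  have htop : (⊤ : Submodule (B ⧸ m) Ω[(B ⧸ m)⁄F]) = ⊥ := by
    rw [← span_range_derivation, Submodule.span_eq_bot]
    rintro _ ⟨x, rfl⟩
    obtain ⟨x, rfl⟩ := Ideal.Quotient.mk_surjective x
    have := map_D R F B (B ⧸ m) x
    rw [hzero] at this
    exact this.symm
  exact (Submodule.subsingleton_iff (B ⧸ m)).mp (subsingleton_of_bot_eq_top htop.symm)

/-- Functions that generate the residue field at `m` and whose differentials generate `Ω[B⁄R]`
modulo `m`. -/
theorem exists_aeval_sub_mem_and_span_sup_smul_eq_top {k : Type u} [Field k] [Algebra R k]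
    (hk : Function.Surjective (algebraMap R k)) (m : Ideal B) [m.IsMaximal]
    [Algebra k (B ⧸ m)] [IsScalarTower R k (B ⧸ m)] [FiniteDimensional k (B ⧸ m)]
    {n : ℕ} (v : Fin (n + 1) → Ω[B⁄R]) (hv : Submodule.span B (Set.range v) ⊔ m • ⊤ = ⊤) :
    ∃ b : Fin (n + 1) → B, (∀ x, ∃ p, x - MvPolynomial.aeval (R := R) b p ∈ m) ∧
      Submodule.span B (Set.range fun i ↦ D R B (b i)) ⊔ m • ⊤ = ⊤ := by
  obtain ⟨hfin, hrank, b, hb⟩ := exists_span_D_sup_smul_eq_top m v hv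
  obtain ⟨c, hc⟩ := exists_adjoin_range_eq_top_of_isSeparable _
    (isSeparable_adjoin_of_span_sup_smul_eq_top (k := k) m b hb)
  choose a ha using fun i ↦ Ideal.Quotient.mk_surjective (I := m) (c i)
  have hgen : ∀ (a : Fin (n + 1) → B), (∀ i, Ideal.Quotient.mk m (a i) = c i) →
      ∀ x, ∃ p, x - MvPolynomial.aeval (R := R) a p ∈ m := by
    intro a ha x
    have hx : Ideal.Quotient.mk m x ∈ Algebra.adjoin k (Set.range c) := hc ▸ trivial
    rw [Algebra.adjoin_range_eq_range_aeval] at hx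
    obtain ⟨p, hp⟩ := hx
    obtain ⟨p, rfl⟩ := MvPolynomial.map_surjective _ hk p
    refine ⟨p, ?_⟩
    rw [← Ideal.Quotient.eq, ← hp]
    change MvPolynomial.aeval c (MvPolynomial.map _ p) = _
    rw [MvPolynomial.aeval_map_algebraMap, ← Ideal.Quotient.algebraMap_eq, ← funext ha,
      ← MvPolynomial.aeval_algebraMap_apply]
    rfl
  let V := Ω[B⁄R] ⧸ m • (⊤ : Submodule B Ω[B⁄R])
  let q : Ω[B⁄R] →ₗ[B] V := Submodule.mkQ _
  have hq : ∀ x, q x = 0 ↔ x ∈ m • (⊤ : Submodule B Ω[B⁄R]) :=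
    fun x ↦ Submodule.Quotient.mk_eq_zero _
  let U : Submodule (B ⧸ m) V :=
    { carrier := {x | ∃ w ∈ m, q (D R B w) = x}
      add_mem' := by
        rintro _ _ ⟨w, hw, rfl⟩ ⟨w', hw', rfl⟩
        exact ⟨w + w', add_mem hw hw', by simp⟩
      zero_mem' := ⟨0, zero_mem _, by simp⟩
      smul_mem' := by
        rintro x _ ⟨w, hw, rfl⟩
        obtain ⟨x, rfl⟩ := Ideal.Quotient.mk_surjective x
        refine ⟨x * w, Ideal.mul_mem_left _ _ hw, ?_⟩
        rw [Derivation.leibniz, map_add, (hq _).mpr (Submodule.smul_mem_smul hw trivial), add_zero,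
          map_smul]
        rfl }
  have hspan : ∀ s : Set Ω[B⁄R], Submodule.span (B ⧸ m) (q '' s) = ⊤ →
      Submodule.span B s ⊔ m • ⊤ = ⊤ := by
    intro s hs
    rw [← Submodule.restrictScalars_eq_top_iff B (B ⧸ m), Submodule.restrictScalars_span B (B ⧸ m)
      Ideal.Quotient.mk_surjective, ← Submodule.map_span] at hs
    rwa [Submodule.map_mkQ_eq_top, sup_comm] at hs
  have hU : U ⊔ Submodule.span (B ⧸ m) (Set.range fun i ↦ q (D R B (a i))) = ⊤ := by
    rw [eq_top_iff]
    have h1 : Submodule.span (B ⧸ m) (q '' (Set.range (D R B))) = ⊤ := by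
      rw [← Submodule.restrictScalars_eq_top_iff B (B ⧸ m), Submodule.restrictScalars_span B (B ⧸ m)
        Ideal.Quotient.mk_surjective, ← Submodule.map_span, span_range_derivation,
        Submodule.map_top, Submodule.range_mkQ]
    rw [← h1, Submodule.span_le]
    rintro _ ⟨_, ⟨x, rfl⟩, rfl⟩
    obtain ⟨p, hp⟩ := hgen a ha x
    have h2 : q (D R B x) =
        q (D R B (x - MvPolynomial.aeval a p)) + q (D R B (MvPolynomial.aeval a p)) := by
      rw [← map_add, ← map_add, sub_add_cancel]
    rw [h2]
    refine Submodule.add_mem_sup ⟨_, hp, rfl⟩ ?_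
    have h3 : q (D R B (MvPolynomial.aeval a p)) ∈ (Submodule.span (B ⧸ m)
        (Set.range fun i ↦ q (D R B (a i)))).restrictScalars B := by
      rw [Submodule.restrictScalars_span B (B ⧸ m) Ideal.Quotient.mk_surjective]
      have := Submodule.mem_map_of_mem (f := q) (D_aeval_mem_span a p)
      rw [Submodule.map_span, ← Set.range_comp] at this
      exact this
    exact h3
  obtain ⟨w, hwU, hw⟩ := exists_forall_mem_span_range_add_eq_top hrank U _ hU
  choose w' hw'm hw' using hwU
  refine ⟨fun i ↦ w' i + a i, hgen _ fun i ↦ ?_, hspan _ ?_⟩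
  · rw [map_add, Ideal.Quotient.eq_zero_iff_mem.mpr (hw'm i), zero_add, ha]
  · rw [← hw, ← Set.range_comp]
    congr 2
    funext i
    simp [hw']

end Coordinates

section Coordinates

open KaehlerDifferential

/-- Over an infinite field, finitely many algebraic elements of extension fields become nonzero and
pairwise non-conjugate after translating them by suitable constants. -/
theorem exists_minpoly_add_algebraMap_ne {k ι : Type*} [Field k] [Infinite k] [Finite ι]
    (K : ι → Type*) [∀ i, Field (K i)] [∀ i, Algebra k (K i)] [∀ i, Algebra.IsIntegral k (K i)]
    (a : ∀ i, K i) :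
    ∃ c : ι → k, ∀ i, a i + algebraMap k (K i) (c i) ≠ 0 ∧ ∀ j, j ≠ i →
      minpoly k (a j + algebraMap k (K j) (c j)) ≠ minpoly k (a i + algebraMap k (K i) (c i)) := by
  classical
  have := Fintype.ofFinite ι
  suffices H : ∀ s : Finset ι, ∃ c : ι → k, ∀ i ∈ s, a i + algebraMap k (K i) (c i) ≠ 0 ∧
      ∀ j ∈ s, j ≠ i → minpoly k (a j + algebraMap k (K j) (c j)) ≠
        minpoly k (a i + algebraMap k (K i) (c i)) by
    obtain ⟨c, hc⟩ := H Finset.univ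
    exact ⟨c, fun i ↦ ⟨(hc i (by simp)).1, fun j ↦ (hc i (by simp)).2 j (by simp)⟩⟩
  intro s
  induction s using Finset.induction_on with
  | empty => exact ⟨0, by simp⟩
  | insert i s hi ih =>
    obtain ⟨c, hc⟩ := ih
    let F : Polynomial k :=
      .X * ∏ j ∈ s, minpoly k (a j + algebraMap k (K j) (c j))
    have hF : F ≠ 0 := mul_ne_zero Polynomial.X_ne_zero
      (Finset.prod_ne_zero_iff.mpr fun j _ ↦ minpoly.ne_zero (Algebra.IsIntegral.isIntegral _))
    have hfin : {x : k | Polynomial.aeval (a i + algebraMap k (K i) x) F = 0}.Finite := by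
      refine ((F.rootSet_finite (K i)).preimage (f := fun x ↦ a i + algebraMap k (K i) x)
        (fun x _ y _ h ↦ (algebraMap k (K i)).injective (add_left_cancel h))).subset ?_
      intro x hx
      exact (Polynomial.mem_rootSet_of_ne hF).mpr hx
    obtain ⟨x, hx⟩ := hfin.exists_notMem
    have hx' : Polynomial.aeval (a i + algebraMap k (K i) x) F ≠ 0 := hx
    rw [map_mul, Polynomial.aeval_X, map_prod] at hx'
    obtain ⟨h0, hprod⟩ := mul_ne_zero_iff.mp hx'
    have hne : ∀ j ∈ s, minpoly k (a j + algebraMap k (K j) (c j)) ≠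
        minpoly k (a i + algebraMap k (K i) x) := by
      intro j hj hjj
      exact Finset.prod_ne_zero_iff.mp hprod j hj (by rw [hjj, minpoly.aeval])
    have hup : ∀ j ∈ s, Function.update c i x j = c j := fun j hj ↦
      Function.update_of_ne (by rintro rfl; exact hi hj) _ _
    refine ⟨Function.update c i x, fun j hj ↦ ?_⟩
    rcases Finset.mem_insert.mp hj with rfl | hjs
    · refine ⟨by simpa using h0, fun l hl hlj ↦ ?_⟩
      rcases Finset.mem_insert.mp hl with rfl | hl
      · exact absurd rfl hlj
      · rw [hup l hl, Function.update_self]; exact hne l hl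
    · rw [hup j hjs]
      refine ⟨(hc j hjs).1, fun l hl hlj ↦ ?_⟩
      rcases Finset.mem_insert.mp hl with rfl | hl
      · rw [Function.update_self]; exact (hne j hjs).symm
      · rw [hup l hl]; exact (hc j hjs).2 l hl hlj

variable {R B : Type u} [CommRing R] [CommRing B] [Algebra R B]

theorem MvPolynomial.aeval_sub_aeval_mem {ι : Type*} {a b : ι → B} (J : Ideal B)
    (h : ∀ i, a i - b i ∈ J) (p : MvPolynomial ι R) : aeval a p - aeval b p ∈ J := by
  rw [← Ideal.Quotient.eq, ← Ideal.Quotient.mkₐ_eq_mk R, MvPolynomial.comp_aeval_apply,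
    MvPolynomial.comp_aeval_apply]
  congr 2
  funext i
  simpa [Ideal.Quotient.eq] using h i

attribute [local instance] Ideal.Quotient.field in
/-- Functions on a smooth algebra over a local ring which, at finitely many closed points of the
closed fibre, are local coordinates, generate the residue field, and separate the points. -/
theorem exists_coordinates [IsLocalRing R] [Algebra.FiniteType R B] {ι : Type*} [Finite ι]
    (m : ι → Ideal B) [∀ i, (m i).IsMaximal] [∀ i, (m i).LiesOver (IsLocalRing.maximalIdeal R)]
    (hm : Function.Injective m) {n : ℕ}
    (hB : ∀ i, ∃ t ∉ m i, Algebra.IsStandardSmoothOfRelativeDimension (n + 1) R (Localization.Away t))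
    (hk : Infinite (IsLocalRing.ResidueField R) ∨ Subsingleton ι) :
    ∃ b : Fin (n + 1) → B, ∀ i, (∀ x, ∃ p, x - MvPolynomial.aeval (R := R) b p ∈ m i) ∧
      Submodule.span B (Set.range fun l ↦ D R B (b l)) ⊔ m i • ⊤ = ⊤ ∧ b 0 ∉ m i ∧
      ∀ j, j ≠ i → ∃ q : Polynomial R, Polynomial.aeval (b 0) q ∈ m i ∧
        Polynomial.aeval (b 0) q ∉ m j := by
  let k := R ⧸ IsLocalRing.maximalIdeal R
  have hsurj : Function.Surjective (algebraMap R k) := Ideal.Quotient.mk_surjective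
  have hft : ∀ i, Algebra.FiniteType k (B ⧸ m i) := fun i ↦
    .of_restrictScalars_finiteType R k (B ⧸ m i)
  have hfd : ∀ i, FiniteDimensional k (B ⧸ m i) := fun i ↦
    finite_of_finite_type_of_isJacobsonRing k (B ⧸ m i)
  have hloc : ∀ i, ∃ b : Fin (n + 1) → B, (∀ x, ∃ p, x - MvPolynomial.aeval (R := R) b p ∈ m i) ∧
      Submodule.span B (Set.range fun l ↦ D R B (b l)) ⊔ m i • ⊤ = ⊤ := by
    intro i
    obtain ⟨t, ht, hst⟩ := hB i
    obtain ⟨v, hv⟩ := exists_kaehlerDifferential_span_sup_smul_eq_top (R := R) (n := n + 1) (m i) ht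
    exact exists_aeval_sub_mem_and_span_sup_smul_eq_top (k := k) hsurj (m i) v hv
  choose a ha1 ha2 using hloc
  obtain ⟨c, hc⟩ : ∃ c : ι → k, ∀ i,
      Ideal.Quotient.mk (m i) (a i 0) + algebraMap k (B ⧸ m i) (c i) ≠ 0 ∧ ∀ j, j ≠ i →
      minpoly k (Ideal.Quotient.mk (m j) (a j 0) + algebraMap k (B ⧸ m j) (c j)) ≠
        minpoly k (Ideal.Quotient.mk (m i) (a i 0) + algebraMap k (B ⧸ m i) (c i)) := by
    rcases hk with hk | hk
    · have : Infinite k := hk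
      exact exists_minpoly_add_algebraMap_ne (fun i ↦ B ⧸ m i) fun i ↦ Ideal.Quotient.mk (m i) (a i 0)
    · classical
      refine ⟨fun i ↦ if Ideal.Quotient.mk (m i) (a i 0) = 0 then 1 else 0, fun i ↦
        ⟨?_, fun j hj ↦ absurd (Subsingleton.elim j i) hj⟩⟩
      dsimp only
      split_ifs with h
      · simp [h]
      · simpa using h
  choose c' hc' using fun i ↦ hsurj (c i)
  have hco : Pairwise (Function.onFun IsCoprime fun i ↦ m i ^ 2) := fun i j hij ↦
    (Ideal.isCoprime_of_isMaximal (fun h ↦ hij (hm h))).pow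
  choose b hb using fun l : Fin (n + 1) ↦ Ideal.exists_forall_sub_mem_ideal hco
    (fun i ↦ a i l + algebraMap R B (if l = 0 then c' i else 0))
  have hle : ∀ i, m i ^ 2 ≤ m i := fun i ↦ Ideal.pow_le_self two_ne_zero
  have hb0 : ∀ i, Ideal.Quotient.mk (m i) (b 0) =
      Ideal.Quotient.mk (m i) (a i 0) + algebraMap k (B ⧸ m i) (c i) := by
    intro i
    rw [Ideal.Quotient.eq.mpr (hle i (hb 0 i)), if_pos rfl, map_add, ← hc' i,
      ← IsScalarTower.algebraMap_apply R k (B ⧸ m i), IsScalarTower.algebraMap_apply R B (B ⧸ m i)]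
    rfl
  refine ⟨b, fun i ↦ ⟨fun x ↦ ?_, ?_, ?_, fun j hji ↦ ?_⟩⟩
  · obtain ⟨p, hp⟩ := ha1 i x
    let s : Fin (n + 1) → MvPolynomial (Fin (n + 1)) R :=
      fun l ↦ .X l - .C (if l = 0 then c' i else 0)
    refine ⟨MvPolynomial.aeval s p, ?_⟩
    have h1 : MvPolynomial.aeval b (MvPolynomial.aeval s p) =
        MvPolynomial.aeval (fun l ↦ b l - algebraMap R B (if l = 0 then c' i else 0)) p := by
      rw [MvPolynomial.comp_aeval_apply]
      congr 2
      funext l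
      simp only [s, map_sub, MvPolynomial.aeval_X, MvPolynomial.algHom_C]
    rw [h1, ← sub_add_sub_cancel x (MvPolynomial.aeval (a i) p)]
    refine add_mem hp (MvPolynomial.aeval_sub_aeval_mem _ (fun l ↦ ?_) p)
    have := hle i (hb l i)
    rw [← neg_mem_iff]
    convert this using 1
    ring
  · refine span_sup_smul_eq_top_of_sub_mem_sq (m i) (fun l ↦ hb l i) ?_
    have h1 : (fun l ↦ D R B (a i l + algebraMap R B (if l = 0 then c' i else 0))) =
        fun l ↦ D R B (a i l) := by
      funext l
      rw [map_add, Derivation.map_algebraMap, add_zero]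
    rw [h1, ha2 i]
  · rw [← Ideal.Quotient.eq_zero_iff_mem, hb0]
    exact (hc i).1
  · obtain ⟨q, hq⟩ := Polynomial.map_surjective (algebraMap R k) hsurj
      (minpoly k (Ideal.Quotient.mk (m i) (b 0)))
    have hev : ∀ j, Ideal.Quotient.mk (m j) (Polynomial.aeval (b 0) q) =
        Polynomial.aeval (Ideal.Quotient.mk (m j) (b 0))
          (minpoly k (Ideal.Quotient.mk (m i) (b 0))) := by
      intro j
      rw [← hq, Polynomial.aeval_map_algebraMap, ← Ideal.Quotient.algebraMap_eq,
        Polynomial.aeval_algebraMap_apply]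
    refine ⟨q, ?_, fun h ↦ ?_⟩
    · rw [← Ideal.Quotient.eq_zero_iff_mem, hev, minpoly.aeval]
    · rw [← Ideal.Quotient.eq_zero_iff_mem, hev] at h
      refine (hc i).2 j hji ?_
      rw [← hb0, ← hb0]
      exact (minpoly.eq_of_irreducible_of_monic
        (minpoly.irreducible (Algebra.IsIntegral.isIntegral _)) h
        (minpoly.monic (Algebra.IsIntegral.isIntegral _))).symm

end Coordinates

section Chains

variable {R B : Type u} [CommRing R] [CommRing B] [Algebra R B]

/-- Every chain of primes of `B` between the ideals `J` and `m` has length at most `d`. -/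
def Ideal.ChainsLE (J m : Ideal B) (d : ℕ) : Prop :=
  ∀ l : LTSeries (PrimeSpectrum B), J ≤ l.head.asIdeal → l.last.asIdeal ≤ m → l.length ≤ d

theorem Ideal.ChainsLE.of_forall_minimalPrimes {J J' m : Ideal B} {d : ℕ} (h : J.ChainsLE m (d + 1))
    (hJ : J ≤ J') (hJ' : ∀ q ∈ J.minimalPrimes, q < m → ¬ J' ≤ q) : J'.ChainsLE m d := by
  intro l hl hlm
  rcases Nat.eq_zero_or_pos l.length with h0 | h0
  · omega
  obtain ⟨q, hq, hqle⟩ := Ideal.exists_minimalPrimes_le (hJ.trans hl)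
  have hlt : l.head < l.last := l.strictMono (Fin.mk_lt_mk.mpr h0 : (0 : Fin _) < Fin.last _)
  have hqm : q < m := (hqle.trans_lt hlt).trans_le hlm
  let Q : PrimeSpectrum B := ⟨q, hq.1.1⟩
  have hQ : Q < l.head := lt_of_le_of_ne hqle fun heq ↦ hJ' q hq hqm (hl.trans (heq.symm.le))
  have := h (l.cons Q hQ) (by simpa using hq.1.2) (by simpa using hlm)
  simpa using this

theorem Ideal.ChainsLE.eq_of_le {J m q : Ideal B} (h : J.ChainsLE m 0) [m.IsPrime] [q.IsPrime]
    (hJ : J ≤ q) (hq : q ≤ m) : q = m := by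
  by_contra hne
  let Q : PrimeSpectrum B := ⟨q, ‹_›⟩
  let M : PrimeSpectrum B := ⟨m, ‹_›⟩
  have hQM : Q < M := lt_of_le_of_ne hq fun h ↦ hne (congrArg PrimeSpectrum.asIdeal h)
  let l : LTSeries (PrimeSpectrum B) := ⟨1, ![Q, M], fun i ↦ by
    rw [Subsingleton.elim i 0]; exact hQM⟩
  exact absurd (h l hJ le_rfl) (by simp [l])

theorem Ideal.height_le_height_under_of_quasiFiniteAt {P : Type u} [CommRing P] [Algebra P B]
    [IsNoetherianRing P] [IsNoetherianRing B] (m : Ideal B) [m.IsPrime]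
    [Algebra.QuasiFiniteAt P m] : m.height ≤ (m.under P).height := by
  have h := Ideal.height_le_height_add_of_liesOver (m.under P) m
  suffices h0 : (m.map (Ideal.Quotient.mk ((m.under P).map (algebraMap P B)))).height = 0 by
    rwa [h0, add_zero] at h
  have hle : (m.under P).map (algebraMap P B) ≤ m := Ideal.map_comap_le
  have hprime : (m.map (Ideal.Quotient.mk ((m.under P).map (algebraMap P B)))).IsPrime :=
    Ideal.map_isPrime_of_surjective Ideal.Quotient.mk_surjective (by simpa using hle)
  rw [Ideal.height_eq_zero_iff]
  refine ⟨⟨hprime, bot_le⟩, fun q hq hqm ↦ ?_⟩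
  have hqp := hq.1
  rw [Ideal.map_le_iff_le_comap]
  have hle' : q.comap (Ideal.Quotient.mk ((m.under P).map (algebraMap P B))) ≤ m := by
    refine (Ideal.comap_mono hqm).trans ?_
    rw [Ideal.comap_map_of_surjective _ Ideal.Quotient.mk_surjective]
    exact sup_le le_rfl (by
      rw [← RingHom.ker_eq_comap_bot, Ideal.mk_ker]; exact hle)
  refine (Algebra.QuasiFiniteAt.eq_of_le_of_under_eq (R := P) hle' (le_antisymm
    (Ideal.comap_mono hle') ?_)).ge
  intro x hx
  have : algebraMap P B x ∈ (m.under P).map (algebraMap P B) := Ideal.mem_map_of_mem _ hx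
  change Ideal.Quotient.mk _ (algebraMap P B x) ∈ q
  rw [Ideal.Quotient.eq_zero_iff_mem.mpr this]
  exact zero_mem q

/-- Chains of primes in the closed fibre of an algebra over a discrete valuation ring that is
étale over affine space. -/
theorem chainsLE_map_maximalIdeal [IsDomain R] [IsDiscreteValuationRing R] {n : ℕ}
    [Algebra (MvPolynomial (Fin n) R) B] [IsScalarTower R (MvPolynomial (Fin n) R) B]
    [Algebra.FiniteType R B] [Module.Flat R B] (m : Ideal B) [m.IsPrime]
    [Algebra.IsEtaleAt (MvPolynomial (Fin n) R) m] :
    ((IsLocalRing.maximalIdeal R).map (algebraMap R B)).ChainsLE m n := by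
  have : IsNoetherianRing B := Algebra.FiniteType.isNoetherianRing R B
  have : Algebra.FiniteType (MvPolynomial (Fin n) R) B :=
    .of_restrictScalars_finiteType R _ _
  have : Algebra.EssFiniteType (MvPolynomial (Fin n) R) (Localization.AtPrime m) :=
    .comp _ B _
  have hh : m.height ≤ (n + 1 : ℕ) := by
    refine (Ideal.height_le_height_under_of_quasiFiniteAt (P := MvPolynomial (Fin n) R) m).trans ?_
    have h1 := Ideal.height_le_ringKrullDim_of_ne_top
      (I := m.under (MvPolynomial (Fin n) R)) Ideal.IsPrime.ne_top'
    rw [MvPolynomial.ringKrullDim_of_isNoetherianRing,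
      IsPrincipalIdealRing.ringKrullDim_eq_one R (IsDiscreteValuationRing.not_isField R)] at h1
    have h2 : ((m.under (MvPolynomial (Fin n) R)).height : WithBot ℕ∞) ≤ ((n + 1 : ℕ) : ℕ∞) := by
      refine h1.trans (le_of_eq ?_)
      simp [add_comm]
    exact_mod_cast h2
  intro l hl hlm
  have hlo : l.head.asIdeal.LiesOver (IsLocalRing.maximalIdeal R) := ⟨
    (IsLocalRing.maximalIdeal.isMaximal R).eq_of_le Ideal.IsPrime.ne_top'
      (Ideal.map_le_iff_le_comap.mp hl)⟩
  obtain ⟨Q, hQ, hQp, -⟩ := Ideal.exists_ideal_lt_liesOver_of_lt (p := (⊥ : Ideal R)) l.head.asIdeal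
    (bot_lt_iff_ne_bot.mpr (IsDiscreteValuationRing.not_a_field R))
  have h1 := Order.length_le_height_last (p := l.cons ⟨Q, hQp⟩ hQ)
  rw [RelSeries.last_cons] at h1
  have h2 : (Order.height l.last : ℕ∞) ≤ m.height := by
    rw [← PrimeSpectrum.height_eq_orderHeight]
    exact Ideal.height_mono hlm
  have h3 := (h1.trans h2).trans hh
  simpa using h3

end Chains

section Transcendence

variable {R B : Type u} [CommRing R] [CommRing B] [Algebra R B]

theorem not_isIntegral_mk_of_lt [IsLocalRing R] {q m : Ideal B} [q.IsPrime] [m.IsPrime] (hqm : q ≤ m)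
    (hq : (IsLocalRing.maximalIdeal R).map (algebraMap R B) ≤ q) {e : B} (he : e ∈ m) (heq : e ∉ q) :
    ¬ IsIntegral R (Ideal.Quotient.mk q e) := by
  intro hint
  let A := Algebra.adjoin R {Ideal.Quotient.mk q e}
  have : Algebra.IsIntegral R A := by
    rw [← le_integralClosure_iff_isIntegral]
    exact Algebra.adjoin_le (by rintro _ rfl; exact hint)
  have hmax : (⊥ : Ideal A).IsMaximal := by
    refine Ideal.isMaximal_of_isIntegral_of_isMaximal_comap (R := R) ⊥ ?_
    have : Ideal.comap (algebraMap R A) ⊥ = IsLocalRing.maximalIdeal R := by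
      refine ((IsLocalRing.maximalIdeal.isMaximal R).eq_of_le Ideal.IsPrime.ne_top' ?_).symm
      intro r hr
      rw [Ideal.mem_comap, Ideal.mem_bot]
      exact Subtype.ext (Ideal.Quotient.eq_zero_iff_mem.mpr (hq (Ideal.mem_map_of_mem _ hr)))
    rw [this]
    exact IsLocalRing.maximalIdeal.isMaximal R
  let x : A := ⟨_, Algebra.subset_adjoin rfl⟩
  have hx : x ∉ (⊥ : Ideal A) := by
    rw [Ideal.mem_bot]
    exact fun h ↦ heq (Ideal.Quotient.eq_zero_iff_mem.mp (congrArg Subtype.val h))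
  obtain ⟨y, i, hi, hy⟩ := hmax.exists_inv hx
  rw [(Ideal.mem_bot).mp hi, add_zero] at hy
  obtain ⟨z, hz⟩ := Ideal.Quotient.mk_surjective (y : B ⧸ q)
  have h1 : Ideal.Quotient.mk q (z * e) = Ideal.Quotient.mk q 1 := by
    rw [map_mul, hz, map_one]
    exact congrArg Subtype.val hy
  have h2 : z * e - 1 ∈ m := hqm (Ideal.Quotient.eq.mp h1)
  exact Ideal.one_notMem m (by simpa using sub_mem (m.mul_mem_left z he) h2)

/-- Moving a function by a suitable power of `e` makes it transcendental modulo finitely many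
primes. -/
theorem exists_pow_not_isIntegral_mk [Nontrivial R] {s : Set (Ideal B)} (hs : s.Finite) (f e : B)
    (he : ∀ q ∈ s, ¬ IsIntegral R (Ideal.Quotient.mk q e)) :
    ∃ N : ℕ, N ≠ 0 ∧ ∀ q ∈ s, ¬ IsIntegral R (Ideal.Quotient.mk q (f + e ^ N)) := by
  have hsub : ∀ q ∈ s,
      {N : ℕ | N ≠ 0 ∧ IsIntegral R (Ideal.Quotient.mk q (f + e ^ N))}.Subsingleton := by
    intro q hq
    have key : ∀ N M : ℕ, N < M → IsIntegral R (Ideal.Quotient.mk q (f + e ^ N)) →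
        IsIntegral R (Ideal.Quotient.mk q (f + e ^ M)) → False := by
      intro N M hNM hN hM
      refine he q hq (.of_aeval_monic (p := Polynomial.X ^ M - Polynomial.X ^ N) ?_ ?_ ?_)
      · exact (Polynomial.monic_X_pow M).sub_of_left (by
          rw [Polynomial.degree_X_pow, Polynomial.degree_X_pow]; exact_mod_cast hNM)
      · rw [Polynomial.natDegree_sub_eq_left_of_natDegree_lt] <;>
          simp only [Polynomial.natDegree_X_pow] <;> omega
      · have h := hM.sub hN
        simpa using h
    intro N hN M hM
    rcases lt_trichotomy N M with h | h | h
    · exact (key N M h hN.2 hM.2).elim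
    · exact h
    · exact (key M N h hM.2 hN.2).elim
  have hfin : (⋃ q ∈ s,
      {N : ℕ | N ≠ 0 ∧ IsIntegral R (Ideal.Quotient.mk q (f + e ^ N))}).Finite :=
    hs.biUnion fun q hq ↦ (hsub q hq).finite
  obtain ⟨N, hN⟩ := (hfin.union (Set.finite_singleton 0)).exists_notMem
  simp only [Set.mem_union, Set.mem_iUnion, Set.mem_ofPred_eq, Set.mem_singleton_iff, not_or,
    not_exists, not_and] at hN
  exact ⟨N, hN.2, fun q hq ↦ hN.1 q hq hN.2⟩

theorem exists_mem_sq_forall_notMem {ι : Type*} [Finite ι] (m : ι → Ideal B)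
    [∀ i, (m i).IsMaximal] {s : Set (Ideal B)} (hs : s.Finite)
    (hs' : ∀ q ∈ s, q.IsPrime ∧ ∃ i, q < m i) : ∃ e : B, (∀ i, e ∈ m i ^ 2) ∧ ∀ q ∈ s, e ∉ q := by
  classical
  have := Fintype.ofFinite ι
  by_contra! hcon
  have hsub : ((Finset.univ.inf fun i ↦ m i ^ 2 : Ideal B) : Set B) ⊆
      ⋃ q ∈ (hs.toFinset : Set (Ideal B)), (q : Set B) := by
    intro e he
    obtain ⟨q, hq, heq⟩ := hcon e fun i ↦ by
      simpa using (Finset.inf_le (f := fun i ↦ m i ^ 2) (Finset.mem_univ i)) he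
    simp only [Set.Finite.coe_toFinset, Set.mem_iUnion]
    exact ⟨q, hq, heq⟩
  obtain ⟨q, hq, hle⟩ := (Ideal.subset_union_prime (s := hs.toFinset) (f := id) ⊥ ⊥
    (fun q hq _ _ ↦ (hs' q (by simpa using hq)).1)).mp hsub
  obtain ⟨hqp, i, hi⟩ := hs' q (by simpa using hq)
  obtain ⟨j, -, hj⟩ := (Ideal.IsPrime.inf_le' hqp).mp hle
  have hjq : m j ≤ q := Ideal.IsPrime.le_of_pow_le hj
  have : m j = m i := Ideal.IsMaximal.eq_of_le inferInstance Ideal.IsPrime.ne_top'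
    (hjq.trans hi.le)
  exact absurd (hjq.trans_lt hi) (by rw [this]; exact lt_irrefl _)

/-- Functions with prescribed second-order expansions whose fibres cut down chains of primes. -/
theorem exists_sub_mem_sq_and_eq_of_chainsLE [IsLocalRing R] [IsNoetherianRing B] {ι : Type*}
    [Finite ι] (m : ι → Ideal B) [∀ i, (m i).IsMaximal] [∀ i, Algebra.IsIntegral R (B ⧸ m i)]
    {d : ℕ} (b : Fin d → B) (J : ι → Ideal B)
    (hR : ∀ i, (IsLocalRing.maximalIdeal R).map (algebraMap R B) ≤ J i)
    (hJ : ∀ i, (J i).ChainsLE (m i) d) :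
    ∃ f : Fin d → B, (∀ l i, f l - b l ∈ m i ^ 2) ∧ ∀ i (q : Ideal B), q.IsPrime → J i ≤ q → q ≤ m i →
      (∀ l, ∀ p : Polynomial R, Polynomial.aeval (f l) p ∈ m i → Polynomial.aeval (f l) p ∈ q) →
      q = m i := by
  induction d generalizing J with
  | zero =>
    exact ⟨b, fun l ↦ l.elim0, fun i q hq hJq hqm _ ↦ (hJ i).eq_of_le hJq hqm⟩
  | succ d ih =>
    let s : Set (Ideal B) := ⋃ i, {q | q ∈ (J i).minimalPrimes ∧ q < m i}
    have hs : s.Finite := Set.finite_iUnion fun i ↦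
      (Ideal.finite_minimalPrimes_of_isNoetherianRing B (J i)).subset fun q hq ↦ hq.1
    have hs' : ∀ q ∈ s, ∃ i, q ∈ (J i).minimalPrimes ∧ q < m i := fun q hq ↦ by
      simpa [s] using hq
    obtain ⟨e, he, heq⟩ := exists_mem_sq_forall_notMem m hs fun q hq ↦ by
      obtain ⟨i, hi, hi'⟩ := hs' q hq
      exact ⟨hi.1.1, i, hi'⟩
    obtain ⟨N, hN0, hN⟩ := exists_pow_not_isIntegral_mk (R := R) hs (b 0) e fun q hq ↦ by
      obtain ⟨i, hi, hi'⟩ := hs' q hq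
      have := hi.1.1
      exact not_isIntegral_mk_of_lt hi'.le ((hR i).trans hi.1.2)
        (Ideal.pow_le_self two_ne_zero (he i)) (heq q hq)
    set f₀ := b 0 + e ^ N
    choose p hpm hp using fun i ↦ Algebra.IsIntegral.isIntegral (R := R) (Ideal.Quotient.mk (m i) f₀)
    have hev : ∀ (q : Ideal B) (p : Polynomial R), Polynomial.eval₂ (algebraMap R (B ⧸ q))
        (Ideal.Quotient.mk q f₀) p = 0 ↔ Polynomial.aeval f₀ p ∈ q := by
      intro q p
      rw [← Ideal.Quotient.eq_zero_iff_mem, ← Polynomial.aeval_def, ← Ideal.Quotient.algebraMap_eq,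
        Polynomial.aeval_algebraMap_apply]
    obtain ⟨f, hf1, hf2⟩ := ih (Fin.tail b) (fun i ↦ J i ⊔ Ideal.span {Polynomial.aeval f₀ (p i)})
      (fun i ↦ (hR i).trans le_sup_left) (fun i ↦ (hJ i).of_forall_minimalPrimes le_sup_left
        fun q hq hqm hle ↦ hN q (Set.mem_iUnion.mpr ⟨i, hq, hqm⟩)
          ⟨p i, hpm i, (hev q _).mpr (hle (Ideal.mem_sup_right (Ideal.mem_span_singleton_self _)))⟩)
    refine ⟨Fin.cons f₀ f, fun l i ↦ ?_, fun i q hq hJq hqm hl ↦ hf2 i q hq ?_ hqm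
      fun l ↦ by simpa using hl l.succ⟩
    · refine Fin.cases ?_ (fun l ↦ ?_) l
      · simpa [f₀] using Ideal.pow_mem_of_mem _ (he i) N (Nat.pos_of_ne_zero hN0)
      · simpa [Fin.tail] using hf1 l i
    · refine sup_le hJq ?_
      rw [Ideal.span_singleton_le_iff_mem]
      exact hl 0 (p i) ((hev _ _).mp (hp i))

/-- A closed point that is minimal in its fibre is isolated in its fibre. -/
theorem quasiFiniteAt_of_forall_eq {P C : Type u} [CommRing P] [CommRing C] [Algebra P C]
    [Algebra.FiniteType P C] [IsNoetherianRing C] (m : Ideal C) [m.IsMaximal]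
    (h : ∀ q : Ideal C, q.IsPrime → q ≤ m → m.under P ≤ q.under P → q = m) :
    Algebra.QuasiFiniteAt P m := by
  classical
  let w := m.under P
  let s := (Ideal.finite_minimalPrimes_of_isNoetherianRing C (w.map (algebraMap P C))).toFinset.erase m
  have hs : ∀ q ∈ s, q ∈ (w.map (algebraMap P C)).minimalPrimes ∧ q ≠ m := fun q hq ↦ by
    simpa [s, and_comm] using hq
  have hle : ¬ s.inf id ≤ m := by
    intro hle
    obtain ⟨q, hq, hqm⟩ := (Ideal.IsPrime.inf_le' inferInstance).mp hle
    exact (hs q hq).2 (h q (hs q hq).1.1.1 hqm (Ideal.map_le_iff_le_comap.mp (hs q hq).1.1.2))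
  obtain ⟨c, hc, hcm⟩ := SetLike.not_le_iff_exists.mp hle
  refine Algebra.QuasiFiniteAt.of_isOpen_singleton_fiber (R := P) (⟨m, inferInstance⟩ : PrimeSpectrum C) ?_
  refine ⟨PrimeSpectrum.basicOpen c, (PrimeSpectrum.basicOpen c).isOpen, ?_⟩
  ext ⟨q, hq⟩
  simp only [Set.mem_preimage, SetLike.mem_coe, PrimeSpectrum.mem_basicOpen, Set.mem_singleton_iff]
  constructor
  · intro hcq
    have hwq : w.map (algebraMap P C) ≤ q.asIdeal := by
      rw [Ideal.map_le_iff_le_comap]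
      exact (congrArg PrimeSpectrum.asIdeal hq).ge
    obtain ⟨q', hq', hqq'⟩ := Ideal.exists_minimalPrimes_le hwq
    have hq'm : q' = m := by
      by_contra hne
      have hq's : q' ∈ s := by simp [s, hne, hq']
      exact hcq (hqq' ((Finset.inf_le (f := id) hq's) hc))
    refine Subtype.ext (PrimeSpectrum.ext ?_)
    exact (Ideal.IsMaximal.eq_of_le inferInstance Ideal.IsPrime.ne_top' (hq'm ▸ hqq')).symm
  · intro heq
    rw [show q = ⟨m, inferInstance⟩ from congrArg Subtype.val heq]
    exact hcm

end Transcendence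

section Avoidance

theorem Ideal.exists_mem_forall_notMem_of_forall_not_le {B ι : Type*} [CommRing B] [Finite ι]
    (J : Ideal B) (p : ι → Ideal B) [∀ i, (p i).IsPrime] (h : ∀ i, ¬ J ≤ p i) :
    ∃ x ∈ J, ∀ i, x ∉ p i := by
  classical
  have := Fintype.ofFinite ι
  rcases isEmpty_or_nonempty ι with _ | ⟨⟨i₀⟩⟩
  · exact ⟨0, J.zero_mem, fun i ↦ isEmptyElim i⟩
  by_contra! hcon
  have hsub : (J : Set B) ⊆ ⋃ i ∈ ((Finset.univ : Finset ι) : Set ι), (p i : Set B) := fun x hx ↦ by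
    obtain ⟨i, hi⟩ := hcon x hx
    simpa using ⟨i, hi⟩
  obtain ⟨i, -, hi⟩ := (Ideal.subset_union_prime (s := Finset.univ) (f := p) i₀ i₀
    (fun i _ _ _ ↦ inferInstance)).mp hsub
  exact h i hi

/-- Congruences modulo `m i ^ 2 ⊔ I` for all `i` lift to congruences modulo `m i ^ 2`. -/
theorem Ideal.exists_sub_mem_and_forall_sub_mem_sq {B ι : Type*} [CommRing B] [Finite ι]
    (m : ι → Ideal B) [∀ i, (m i).IsMaximal] (hm : Function.Injective m) (I : Ideal B) (b c : B)
    (h : ∀ i, c - b ∈ m i ^ 2 ⊔ I) : ∃ f : B, f - c ∈ I ∧ ∀ i, f - b ∈ m i ^ 2 := by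
  classical
  have := Fintype.ofFinite ι
  have hco : Pairwise (Function.onFun IsCoprime fun i ↦ m i ^ 2) := fun i j hij ↦
    (Ideal.isCoprime_of_isMaximal (fun h ↦ hij (hm h))).pow
  choose u hu e he hue using fun i ↦ Submodule.mem_sup.mp (h i)
  choose t ht using fun i : ι ↦ Ideal.exists_forall_sub_mem_ideal hco
    (fun j ↦ if j = i then (1 : B) else 0)
  refine ⟨c - ∑ i, t i * e i, ?_, fun j ↦ ?_⟩
  · rw [sub_sub_cancel_left, neg_mem_iff]
    exact _root_.sum_mem fun i _ ↦ I.mul_mem_left _ (he i)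
  · have h1 : c - ∑ i, t i * e i - b =
        u j - ∑ i, (t i - if j = i then (1 : B) else 0) * e i := by
      simp only [sub_mul, Finset.sum_sub_distrib, ite_mul, one_mul, zero_mul, Finset.sum_ite_eq,
        Finset.mem_univ, if_true]
      linear_combination (-1 : B) * hue j
    rw [h1]
    exact sub_mem (hu j) (_root_.sum_mem fun i _ ↦ Ideal.mul_mem_right _ _ (ht i j))

end Avoidance

section Unramified

theorem exists_mul_mem_map_under_of_isUnramifiedAt {P B : Type*} [CommRing P] [CommRing B]
    [Algebra P B] [Algebra.EssFiniteType P B] (m : Ideal B) [m.IsPrime] [Algebra.IsUnramifiedAt P m]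
    {x : B} (hx : x ∈ m) : ∃ s ∉ m, s * x ∈ (m.under P).map (algebraMap P B) := by
  let := Localization.AtPrime.algebraOfLiesOver (m.under P) m
  have h := ((Algebra.isUnramifiedAt_iff_map_eq P (m.under P) m).mp inferInstance).2
  have h1 : algebraMap B (Localization.AtPrime m) x ∈
      ((m.under P).map (algebraMap P B)).map (algebraMap B (Localization.AtPrime m)) := by
    rw [Ideal.map_map, ← IsScalarTower.algebraMap_eq, h]
    exact (IsLocalization.AtPrime.to_map_mem_maximal_iff (Localization.AtPrime m) m x).mpr hx
  obtain ⟨s, hs, hsx⟩ := (IsLocalization.algebraMap_mem_map_algebraMap_iff m.primeCompl _ _ _).mp h1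
  exact ⟨s, hs, hsx⟩

end Unramified

section ZariskiMain

/-- Zariski's main theorem at finitely many points. -/
theorem exists_finite_subalgebra_forall_pow_mul_mem {P C ι : Type*} [CommRing P] [CommRing C]
    [Algebra P C] [Algebra.FiniteType P C] [Finite ι] (m : ι → Ideal C) [∀ i, (m i).IsPrime]
    [∀ i, Algebra.QuasiFiniteAt P (m i)] :
    ∃ E : Subalgebra P C, Module.Finite P E ∧ ∃ s ∈ E, (∀ i, s ∉ m i) ∧
      ∀ c, ∃ N : ℕ, s ^ N * c ∈ E := by
  classical
  have := Fintype.ofFinite ι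
  have hloc : ∀ i, ∃ E : Subalgebra P C, Module.Finite P E ∧ ∃ s ∈ E, s ∉ m i ∧
      ∀ c, ∃ N : ℕ, s ^ N * c ∈ E := by
    intro i
    obtain ⟨E, hE, r, hr, hbij⟩ :=
      Algebra.QuasiFiniteAt.exists_fg_and_exists_notMem_and_awayMap_bijective (R := P) (m i)
    refine ⟨E, ⟨(Submodule.fg_top _).mpr hE⟩, r, r.2, hr, fun c ↦ ?_⟩
    obtain ⟨y, hy⟩ := hbij.2 (algebraMap C _ c)
    obtain ⟨⟨a, ⟨_, N, rfl⟩⟩, ha⟩ := IsLocalization.surj (Submonoid.powers r) y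
    have h1 := congrArg (Localization.awayMap E.val.toRingHom r) ha
    rw [map_mul, hy] at h1
    simp only [Localization.awayMap, IsLocalization.Away.map, IsLocalization.map_eq] at h1
    rw [← map_mul] at h1
    obtain ⟨⟨_, M, rfl⟩, hM⟩ :=
      (IsLocalization.eq_iff_exists (Submonoid.powers (E.val.toRingHom r)) _).mp h1
    refine ⟨M + N, ?_⟩
    have h2 : (r : C) ^ M * (c * (r : C) ^ N) = (r : C) ^ M * a := by simpa using hM
    rw [pow_add, mul_assoc, mul_comm ((r : C) ^ N) c, h2]
    exact E.mul_mem (E.pow_mem r.2 _) a.2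
  choose E hE s hs hsm hsc using hloc
  have hfin : ∀ t : Finset ι, Module.Finite P (t.sup E : Subalgebra P C) := by
    intro t
    induction t using Finset.induction_on with
    | empty => rw [Finset.sup_empty]; infer_instance
    | insert i t _ ih => rw [Finset.sup_insert]; exact Subalgebra.finite_sup _ _
  have hle : ∀ i, E i ≤ Finset.univ.sup E := fun i ↦ Finset.le_sup (Finset.mem_univ i)
  set F := Finset.univ.sup E
  let cond : C → Ideal F := fun c ↦
    { carrier := {x | (x : C) * c ∈ F}
      add_mem' := fun {x y} hx hy ↦ by
        change ((x + y : F) : C) * c ∈ F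
        rw [F.coe_add, add_mul]; exact F.add_mem hx hy
      zero_mem' := by change ((0 : F) : C) * c ∈ F; simp
      smul_mem' := fun a x hx ↦ by
        change ((a * x : F) : C) * c ∈ F
        rw [F.coe_mul, mul_assoc]; exact F.mul_mem a.2 hx }
  obtain ⟨x, hx, hxm⟩ := Ideal.exists_mem_forall_notMem_of_forall_not_le (⨅ c, (cond c).radical)
    (fun i ↦ (m i).comap (algebraMap F C)) fun i hi ↦ by
      refine hsm i (hi (x := ⟨s i, hle i (hs i)⟩) (Submodule.mem_iInf _ |>.mpr fun c ↦ ?_))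
      obtain ⟨N, hN⟩ := hsc i c
      exact ⟨N, hle i hN⟩
  refine ⟨F, hfin _, x, x.2, fun i ↦ hxm i, fun c ↦ ?_⟩
  obtain ⟨N, hN⟩ := (Submodule.mem_iInf _).mp hx c
  exact ⟨N, by rw [← F.coe_pow]; exact hN⟩

end ZariskiMain

section Nakayama

/-- A criterion for a finite algebra to be, near finitely many points, a quotient of the base. -/
theorem exists_forall_smul_mem_range_of_forall_eq {P E ι : Type*} [CommRing P] [CommRing E]
    [Algebra P E] [Module.Finite P E] [Finite ι] (n : ι → Ideal E) [∀ i, (n i).IsMaximal]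
    (h1 : ∀ i (q : Ideal E), q.IsMaximal → (n i).under P ≤ q.under P → q = n i)
    (h2 : ∀ i, ∀ x ∈ n i, ∃ t ∉ n i, t * x ∈ ((n i).under P).map (algebraMap P E))
    (h3 : ∀ i x, ∃ p, x - algebraMap P E p ∈ n i) :
    ∃ p : P, (∀ i, p ∉ (n i).under P) ∧ ∀ x : E, p • x ∈ Set.range (algebraMap P E) := by
  have hmap : ∀ i, ((n i).under P).map (algebraMap P E) = n i := by
    refine fun i ↦ le_antisymm Ideal.map_comap_le fun x hx ↦ ?_
    let K : Ideal E := (((n i).under P).map (algebraMap P E)).colon {x}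
    have hK : K = ⊤ := by
      by_contra hK
      obtain ⟨q, hq, hKq⟩ := Ideal.exists_le_maximal K hK
      have hq' : q = n i := h1 i q hq (Ideal.map_le_iff_le_comap.mp (le_trans (fun y hy ↦
        Submodule.mem_colon_singleton.mpr (Ideal.mul_mem_right _ _ hy)) hKq))
      obtain ⟨t, ht, htx⟩ := h2 i x hx
      exact ht (hq' ▸ hKq (Submodule.mem_colon_singleton.mpr htx))
    have h1K : (1 : E) ∈ K := hK ▸ trivial
    simpa using Submodule.mem_colon_singleton.mp h1K
  let N : Submodule P E := LinearMap.range (Algebra.linearMap P E)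
  obtain ⟨p, hp, hpn⟩ := Ideal.exists_mem_forall_notMem_of_forall_not_le
    (N.colon Set.univ) (fun i ↦ (n i).under P) fun i hi ↦ by
      obtain ⟨s, hs, hsN⟩ := Submodule.exists_sub_one_mem_forall_smul_mem_of_sup_smul_eq_top
        ((n i).under P) N (by
          rw [Ideal.smul_top_eq_map, hmap, eq_top_iff]
          intro x _
          obtain ⟨p, hp⟩ := h3 i x
          rw [← sub_add_cancel x (algebraMap P E p)]
          exact add_mem (Submodule.mem_sup_right hp) (Submodule.mem_sup_left ⟨p, rfl⟩))
      have hsn : s ∈ (n i).under P := hi (Submodule.mem_colon.mpr fun x _ ↦ hsN x)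
      exact Ideal.one_notMem ((n i).under P) (by simpa using sub_mem hsn hs)
  exact ⟨p, hpn, fun x ↦ by
    obtain ⟨y, hy⟩ := Submodule.mem_colon.mp hp x trivial
    exact ⟨y, hy⟩⟩

end Nakayama

section Separation

/-- In a finite subalgebra `E` of `C` that is locally equal to `C` at finitely many closed points
`m i`, there are elements with prescribed second-order expansions at these points, vanishing at all
the other points of the same fibres. -/
theorem exists_sub_mem_sq_and_forall_mem_of_ne {P C ι : Type*} [CommRing P] [CommRing C]
    [Algebra P C] [Finite ι] (m : ι → Ideal C) [∀ i, (m i).IsMaximal] (hm : Function.Injective m)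
    (E : Subalgebra P C) [Module.Finite P E] [∀ i, ((m i).comap (algebraMap E C)).IsMaximal]
    {s : C} (hsE : s ∈ E) (hsm : ∀ i, s ∉ m i) (hs : ∀ c, ∃ N : ℕ, s ^ N * c ∈ E) (b : C) :
    ∃ c ∈ E, (∀ i, c - b ∈ m i ^ 2) ∧ ∀ q : Ideal E, q.IsPrime →
      (∃ i, (m i).under P = q.under P) → (∀ j, q ≠ (m j).comap (algebraMap E C)) →
      ∀ hc : c ∈ E, ⟨c, hc⟩ ∈ q := by
  classical
  set n : ι → Ideal E := fun i ↦ (m i).comap (algebraMap E C)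
  have hninj : Function.Injective n := by
    intro i j hij
    refine hm (Ideal.IsMaximal.eq_of_le inferInstance Ideal.IsPrime.ne_top' fun x hx ↦ ?_)
    obtain ⟨N, hN⟩ := hs x
    have h1 : (⟨_, hN⟩ : E) ∈ n i := (m i).mul_mem_left _ hx
    rw [hij] at h1
    have h2 : s ^ N * x ∈ m j := h1
    exact (Ideal.IsPrime.mem_or_mem inferInstance h2).resolve_left
      fun h ↦ hsm j (Ideal.IsPrime.mem_of_pow_mem inferInstance _ h)
  have hloc : ∀ i, ∃ e : E, (e : C) - b ∈ m i ^ 2 := by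
    intro i
    obtain ⟨N, hN⟩ := hs b
    have hco : IsCoprime (Ideal.span {(⟨s, hsE⟩ : E) ^ N}) (n i ^ 2) := by
      rw [← Ideal.span_singleton_pow]
      refine IsCoprime.pow ?_
      rw [Ideal.isCoprime_iff_sup_eq, sup_comm]
      have hni : (n i).IsMaximal := inferInstance
      exact hni.1.2 _ (left_lt_sup.mpr fun h ↦ hsm i (h (Ideal.mem_span_singleton_self _)))
    obtain ⟨x, hx, y, hy, hxy⟩ := Ideal.isCoprime_iff_exists.mp hco
    obtain ⟨a, rfl⟩ := Ideal.mem_span_singleton'.mp hx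
    refine ⟨a * ⟨_, hN⟩, ?_⟩
    have h1 : ((a * ⟨_, hN⟩ : E) : C) - b = -(y : C) * b := by
      have := congrArg (Subtype.val) hxy
      simp only [E.coe_add, E.coe_mul, E.coe_pow, E.coe_one] at this ⊢
      linear_combination b * this
    rw [h1]
    refine Ideal.mul_mem_right _ _ (neg_mem ?_)
    exact (Ideal.le_comap_pow (algebraMap E C) 2) hy
  choose e he using hloc
  let T : Set (Ideal E) := (⋃ i, ((m i).under P).primesOver E) \ Set.range n
  have hT : T.Finite := (Set.finite_iUnion fun i ↦
    Algebra.QuasiFinite.finite_primesOver ((m i).under P)).subset Set.sdiff_subset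
  have : Finite T := hT
  have hTmax : ∀ q : T, q.1.IsMaximal := by
    rintro ⟨q, hq, -⟩
    obtain ⟨i, hqp, hqo⟩ := Set.mem_iUnion.mp hq
    refine Ideal.isMaximal_of_isIntegral_of_isMaximal_comap (R := P) q ?_
    have h1 : q.comap (algebraMap P E) = (n i).comap (algebraMap P E) := hqo.over.symm
    rw [h1]
    exact Ideal.isMaximal_comap_of_isIntegral_of_isMaximal _
  let K : ι ⊕ T → Ideal E := Sum.elim (fun i ↦ n i ^ 2) (fun q ↦ q.1)
  have hK : Pairwise (Function.onFun IsCoprime K) := by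
    rintro (i | q) (j | r) hne
    · exact (Ideal.isCoprime_of_isMaximal fun h ↦ hne (congrArg Sum.inl (hninj h))).pow
    · have := hTmax r
      change IsCoprime (n i ^ 2) r.1
      exact IsCoprime.pow_left (Ideal.isCoprime_of_isMaximal fun h ↦ r.2.2 ⟨i, h⟩)
    · have := hTmax q
      change IsCoprime q.1 (n j ^ 2)
      exact IsCoprime.pow_right (Ideal.isCoprime_of_isMaximal fun h ↦ q.2.2 ⟨j, h.symm⟩)
    · have := hTmax q
      have := hTmax r
      change IsCoprime q.1 r.1
      exact Ideal.isCoprime_of_isMaximal fun h ↦ hne (congrArg Sum.inr (Subtype.ext h))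
  obtain ⟨c, hc⟩ := Ideal.exists_forall_sub_mem_ideal hK (Sum.elim e fun _ ↦ 0)
  refine ⟨c, c.2, fun i ↦ ?_, fun q hq hqi hqn hcE ↦ ?_⟩
  · rw [← sub_add_sub_cancel _ (e i : C)]
    exact add_mem ((Ideal.le_comap_pow (algebraMap E C) 2) (hc (Sum.inl i))) (he i)
  · obtain ⟨i, hi⟩ := hqi
    have hqT : q ∈ T := ⟨Set.mem_iUnion.mpr ⟨i, hq, ⟨hi⟩⟩, fun ⟨j, hj⟩ ↦ hqn j hj.symm⟩
    simpa [K] using hc (Sum.inr ⟨q, hqT⟩)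

end Separation

section Surjectivity

open MvPolynomial

variable {R B : Type u} [CommRing R] [CommRing B] [Algebra R B]

theorem exists_mul_sub_mem_of_subalgebra {ι σ : Type*} [Finite ι] (I : Ideal B) (m : ι → Ideal B)
    [∀ i, (m i).IsMaximal] (f : σ → B) (E : Subalgebra R (B ⧸ I))
    (hfE : ∀ l, Ideal.Quotient.mk I (f l) ∈ E)
    (hfin : (aeval (R := R) (fun l ↦ (⟨_, hfE l⟩ : E))).toRingHom.Finite)
    (hI : ∀ i, I ≤ m i)
    [∀ i, (((m i).map (Ideal.Quotient.mk I)).comap (algebraMap E (B ⧸ I))).IsMaximal]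
    {s : B} (hsE : Ideal.Quotient.mk I s ∈ E) (hsm : ∀ i, s ∉ m i)
    (hs : ∀ c, ∃ N : ℕ, Ideal.Quotient.mk I (s ^ N * c) ∈ E)
    (hfib : ∀ i (q : Ideal E), q.IsMaximal →
      (∀ p : MvPolynomial σ R, aeval f p ∈ m i → aeval (fun l ↦ (⟨_, hfE l⟩ : E)) p ∈ q) →
      q = ((m i).map (Ideal.Quotient.mk I)).comap (algebraMap E (B ⧸ I)))
    (hunr : ∀ i, ∀ x ∈ m i, ∃ t ∉ m i,
      t * x ∈ ((m i).comap (aeval (R := R) f)).map (aeval (R := R) f))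
    (hgen : ∀ i x, ∃ p : MvPolynomial σ R, x - aeval f p ∈ m i) (b : B) :
    ∃ p₀ p : MvPolynomial σ R, (∀ i, aeval f p₀ ∉ m i) ∧ aeval f p₀ * b - aeval f p ∈ I := by
  set ψ : MvPolynomial σ R →ₐ[R] E := aeval (fun l ↦ (⟨_, hfE l⟩ : E))
  let mk := Ideal.Quotient.mk I
  have hψ : ∀ p, (ψ p : B ⧸ I) = mk (aeval f p) := by
    intro p
    have h1 : E.val.comp ψ = (Ideal.Quotient.mkₐ R I).comp (aeval f) := by
      ext l
      simp [ψ]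
    exact DFunLike.congr_fun h1 p
  have hmem : ∀ i x, mk x ∈ (m i).map mk ↔ x ∈ m i := by
    intro i x
    rw [← Ideal.mem_comap, Ideal.comap_map_of_surjective _ Ideal.Quotient.mk_surjective,
      ← RingHom.ker_eq_comap_bot, Ideal.mk_ker, sup_eq_left.mpr (hI i)]
  set n : ι → Ideal E := fun i ↦ ((m i).map mk).comap (algebraMap E (B ⧸ I))
  have hn : ∀ i x (hx : mk x ∈ E), (⟨mk x, hx⟩ : E) ∈ n i ↔ x ∈ m i := fun i x hx ↦ hmem i x
  have hnψ : ∀ i p, ψ p ∈ n i ↔ aeval f p ∈ m i := by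
    intro i p
    rw [← hmem, ← hψ]; rfl
  let : Algebra (MvPolynomial σ R) E := ψ.toRingHom.toAlgebra
  have hfin' : Module.Finite (MvPolynomial σ R) E := hfin
  obtain ⟨p₀, hp₀, hp₀E⟩ := exists_forall_smul_mem_range_of_forall_eq (P := MvPolynomial σ R) n
    (fun i q hq hle ↦ hfib i q hq fun p hp ↦ hle ((hnψ i p).mpr hp))
    (fun i x hx ↦ by
      obtain ⟨x, hxE⟩ := x
      obtain ⟨x, rfl⟩ := Ideal.Quotient.mk_surjective x
      obtain ⟨t, ht, htx⟩ := hunr i x ((hn i x hxE).mp hx)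
      have key : ∀ z ∈ ((m i).comap (aeval (R := R) f)).map (aeval (R := R) f), ∃ N : ℕ, ∃ z' ∈
          ((n i).under (MvPolynomial σ R)).map (algebraMap (MvPolynomial σ R) E),
          (z' : B ⧸ I) = mk (s ^ N * z) := by
        intro z hz
        induction hz using Submodule.span_induction with
        | mem z hz =>
          obtain ⟨p, hp, rfl⟩ := hz
          exact ⟨0, ψ p, Ideal.mem_map_of_mem _ ((hnψ i p).mpr hp), by rw [hψ]; simp⟩
        | zero => exact ⟨0, 0, zero_mem _, by simp⟩
        | add z w _ _ hz hw =>
          obtain ⟨N, z', hz', hz⟩ := hz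
          obtain ⟨M, w', hw', hw⟩ := hw
          refine ⟨N + M, ⟨_, hsE⟩ ^ M * z' + ⟨_, hsE⟩ ^ N * w',
            add_mem (Ideal.mul_mem_left _ _ hz') (Ideal.mul_mem_left _ _ hw'), ?_⟩
          simp only [E.coe_add, E.coe_mul, E.coe_pow, hz, hw]
          simp only [← map_pow, ← map_mul, ← map_add, mk]
          congr 1
          ring
        | smul a z _ hz =>
          obtain ⟨N, z', hz', hz⟩ := hz
          obtain ⟨M, hM⟩ := hs a
          refine ⟨M + N, ⟨_, hM⟩ * z', Ideal.mul_mem_left _ _ hz', ?_⟩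
          simp only [E.coe_mul, hz, smul_eq_mul]
          simp only [← map_mul, mk]
          congr 1
          ring
      obtain ⟨N, z, hz, hzx⟩ := key _ htx
      obtain ⟨M, hM⟩ := hs t
      refine ⟨⟨_, hsE⟩ ^ N * ⟨_, hM⟩, ?_, ?_⟩
      · refine Ideal.IsPrime.mul_notMem inferInstance
          (fun h ↦ hsm i ((hn i s hsE).mp (Ideal.IsPrime.mem_of_pow_mem inferInstance _ h))) ?_
        rw [hn]
        exact Ideal.IsPrime.mul_notMem inferInstance
          (fun h ↦ hsm i (Ideal.IsPrime.mem_of_pow_mem inferInstance _ h)) ht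
      · have h1 : (⟨_, hsE⟩ ^ N * ⟨_, hM⟩ * ⟨mk x, hxE⟩ : E) = ⟨_, hsE⟩ ^ M * z := by
          refine Subtype.ext ?_
          simp only [E.coe_mul, E.coe_pow, hzx]
          simp only [← map_pow, ← map_mul, mk]
          congr 1
          ring
        rw [h1]
        exact Ideal.mul_mem_left _ _ hz)
    (fun i x ↦ by
      obtain ⟨x, hxE⟩ := x
      obtain ⟨x, rfl⟩ := Ideal.Quotient.mk_surjective x
      obtain ⟨p, hp⟩ := hgen i x
      refine ⟨p, ?_⟩
      change ((Ideal.Quotient.mk I x : B ⧸ I) - (ψ p : B ⧸ I)) ∈ (m i).map mk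
      rw [hψ, ← map_sub]
      exact (hmem i _).mpr hp)
  have hp₀' : ∀ x, mk x ∈ E →
      ∃ p : MvPolynomial σ R, mk (aeval f p₀ * x) = mk (aeval f p) := by
    intro x hx
    obtain ⟨p, hp⟩ := hp₀E ⟨_, hx⟩
    refine ⟨p, ?_⟩
    have h1 := congrArg Subtype.val hp
    rw [Algebra.smul_def] at h1
    change (ψ p : B ⧸ I) = (ψ p₀ : B ⧸ I) * mk x at h1
    rw [hψ, hψ, ← map_mul] at h1
    exact h1.symm
  have hp₀m : ∀ i, aeval f p₀ ∉ m i := fun i h ↦ hp₀ i ((hnψ i _).mpr h)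
  obtain ⟨p₁, hp₁⟩ := hp₀' s hsE
  have hp₁m : ∀ i, aeval f p₁ ∉ m i := by
    intro i h
    rw [← hmem, ← hp₁, hmem] at h
    exact Ideal.IsPrime.mul_notMem inferInstance (hp₀m i) (hsm i) h
  obtain ⟨N, hN⟩ := hs b
  obtain ⟨p₂, hp₂⟩ := hp₀' _ hN
  refine ⟨p₁ ^ N * p₀, p₀ ^ N * p₂, fun i ↦ ?_, ?_⟩
  · rw [map_mul, map_pow]
    exact Ideal.IsPrime.mul_notMem inferInstance
      (fun h ↦ hp₁m i (Ideal.IsPrime.mem_of_pow_mem inferInstance _ h)) (hp₀m i)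
  · rw [← Ideal.Quotient.eq]
    change mk _ = mk _
    simp only [map_mul, map_pow, ← hp₁, ← hp₂]
    ring

end Surjectivity

section Presentation

open MvPolynomial KaehlerDifferential

variable {R B : Type u} [CommRing R] [CommRing B] [Algebra R B]

theorem Ideal.isMaximal_comap_of_isIntegral_quotient {A : Type*} [CommRing A] [Algebra R A]
    (φ : A →ₐ[R] B) (m : Ideal B) [m.IsMaximal] [Algebra.IsIntegral R (B ⧸ m)] :
    (m.comap φ).IsMaximal := by
  let f : A →+* B ⧸ m := (Ideal.Quotient.mk m).comp φ
  have hf : f.IsIntegral := by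
    refine RingHom.IsIntegral.tower_top (algebraMap R A) f ?_
    have h : f.comp (algebraMap R A) = algebraMap R (B ⧸ m) := by
      ext r
      change Ideal.Quotient.mk m (φ (algebraMap R A r)) = _
      rw [AlgHom.commutes]
      rfl
    rw [h]
    exact fun x ↦ Algebra.IsIntegral.isIntegral x
  let := Ideal.Quotient.field m
  have h := Ideal.isMaximal_comap_of_isIntegral_of_isMaximal' f hf (⊥ : Ideal (B ⧸ m))
  have h1 : (⊥ : Ideal (B ⧸ m)).comap f = m.comap φ := by
    ext a
    exact Ideal.Quotient.eq_zero_iff_mem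
  rwa [h1] at h

attribute [local instance] Ideal.Quotient.field in
theorem finite_quotient_of_isMaximal_of_liesOver [IsLocalRing R] [Algebra.FiniteType R B]
    (m : Ideal B) [m.IsMaximal] [m.LiesOver (IsLocalRing.maximalIdeal R)] :
    Module.Finite R (B ⧸ m) := by
  let k := R ⧸ IsLocalRing.maximalIdeal R
  have : Algebra.FiniteType k (B ⧸ m) := .of_restrictScalars_finiteType R k (B ⧸ m)
  have : Module.Finite k (B ⧸ m) := finite_of_finite_type_of_isJacobsonRing k (B ⧸ m)
  have : Module.Finite R k := .of_surjective (Algebra.linearMap R k) Ideal.Quotient.mk_surjective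
  exact .trans k (B ⧸ m)

theorem Polynomial.aeval_sub_aeval_mem (J : Ideal B) {a b : B} (h : a - b ∈ J) (p : Polynomial R) :
    Polynomial.aeval a p - Polynomial.aeval b p ∈ J := by
  simp only [Polynomial.aeval_def, Polynomial.eval₂_eq_eval_map]
  exact J.mem_of_dvd (Polynomial.sub_dvd_eval_sub a b _) h

theorem chainsLE_map_maximalIdeal_of_span_sup_smul_eq_top [IsDomain R] [IsDiscreteValuationRing R]
    [Algebra.Smooth R B] (m : Ideal B) [m.IsPrime] {n : ℕ} (b : Fin n → B)
    (hB : ∃ t ∉ m, Algebra.IsStandardSmoothOfRelativeDimension n R (Localization.Away t))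
    (hb : Submodule.span B (Set.range fun l ↦ D R B (b l)) ⊔ m • ⊤ = ⊤) :
    ((IsLocalRing.maximalIdeal R).map (algebraMap R B)).ChainsLE m n := by
  obtain ⟨t, ht, _⟩ := hB
  let := (aeval (R := R) b).toRingHom.toAlgebra
  have : IsScalarTower R (MvPolynomial (Fin n) R) B := .of_algebraMap_eq' (aeval b).comp_algebraMap.symm
  have h : ∀ i, algebraMap (MvPolynomial (Fin n) R) B (X i) = b i := fun i ↦ aeval_X b i
  have : Algebra.IsEtaleAt (MvPolynomial (Fin n) R) m :=
    isEtaleAt_of_span_sup_smul_eq_top m ht (by simpa only [h] using hb)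
  exact chainsLE_map_maximalIdeal m

theorem exists_mul_mem_map_comap_of_span_sup_smul_eq_top [Algebra.Smooth R B]
    (m : Ideal B) [m.IsPrime] {n : ℕ} (b : Fin n → B)
    (hB : ∃ t ∉ m, Algebra.IsStandardSmoothOfRelativeDimension n R (Localization.Away t))
    (hb : Submodule.span B (Set.range fun l ↦ D R B (b l)) ⊔ m • ⊤ = ⊤) {x : B} (hx : x ∈ m) :
    ∃ s ∉ m, s * x ∈ (m.comap (aeval (R := R) b)).map (aeval (R := R) b) := by
  obtain ⟨t, ht, _⟩ := hB
  let := (aeval (R := R) b).toRingHom.toAlgebra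
  have : IsScalarTower R (MvPolynomial (Fin n) R) B := .of_algebraMap_eq' (aeval b).comp_algebraMap.symm
  have h : ∀ i, algebraMap (MvPolynomial (Fin n) R) B (X i) = b i := fun i ↦ aeval_X b i
  have : Algebra.IsEtaleAt (MvPolynomial (Fin n) R) m :=
    isEtaleAt_of_span_sup_smul_eq_top m ht (by simpa only [h] using hb)
  have : Algebra.FiniteType (MvPolynomial (Fin n) R) B := .of_restrictScalars_finiteType R _ _
  exact exists_mul_mem_map_under_of_isUnramifiedAt m hx

/-- A geometric presentation at finitely many closed points: coordinates that are étale at the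
points and for which the closed subscheme `I` is, near the points, a closed subscheme of affine
space. -/
theorem exists_presentation [IsDomain R] [IsDiscreteValuationRing R] [Algebra.Smooth R B]
    {ι : Type*} [Finite ι] (m : ι → Ideal B) [∀ i, (m i).IsMaximal]
    [∀ i, (m i).LiesOver (IsLocalRing.maximalIdeal R)] (hm : Function.Injective m) {d : ℕ}
    (hB : ∀ i, ∃ t ∉ m i, Algebra.IsStandardSmoothOfRelativeDimension (d + 1) R (Localization.Away t))
    (hk : Infinite (IsLocalRing.ResidueField R) ∨ Subsingleton ι) (I : Ideal B) (hI : ∀ i, I ≤ m i)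
    (hcomp : ∀ q ∈ ((IsLocalRing.maximalIdeal R).map (algebraMap R B)).minimalPrimes, ¬ I ≤ q) :
    ∃ f : Fin (d + 1) → B,
      (∀ i, Submodule.span B (Set.range fun l ↦ D R B (f l)) ⊔ m i • ⊤ = ⊤) ∧
      ∀ b, ∃ p₀ p : MvPolynomial (Fin (d + 1)) R, (∀ i, aeval f p₀ ∉ m i) ∧
        aeval f p₀ * b - aeval f p ∈ I := by
  have : IsNoetherianRing B := Algebra.FiniteType.isNoetherianRing R B
  obtain ⟨b, hb⟩ := exists_coordinates m hm hB hk
  have hfinite : ∀ i, Module.Finite R (B ⧸ m i) := fun i ↦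
    finite_quotient_of_isMaximal_of_liesOver (m i)
  obtain ⟨g, hg, hgm⟩ := exists_sub_mem_sq_and_eq_of_chainsLE m (fun l : Fin d ↦ b l.succ)
    (fun _ ↦ (IsLocalRing.maximalIdeal R).map (algebraMap R B) ⊔ I) (fun _ ↦ le_sup_left)
    fun i ↦ (chainsLE_map_maximalIdeal_of_span_sup_smul_eq_top (m i) b (hB i)
      (hb i).2.1).of_forall_minimalPrimes le_sup_left
        fun q hq _ hle ↦ hcomp q hq (le_sup_right.trans hle)
  let P := MvPolynomial (Fin d) R
  let C := B ⧸ I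
  let mk : B →+* C := Ideal.Quotient.mk I
  let φ : P →ₐ[R] C := (Ideal.Quotient.mkₐ R I).comp (aeval g)
  let : Algebra P C := φ.toRingHom.toAlgebra
  have : IsScalarTower R P C := .of_algebraMap_eq' φ.comp_algebraMap.symm
  have hφ : ∀ p, algebraMap P C p = mk (aeval g p) := fun p ↦ rfl
  have hmk : Function.Surjective mk := Ideal.Quotient.mk_surjective
  have hcm : ∀ J : Ideal B, (J.map mk).comap mk = J ⊔ I := fun J ↦ by
    rw [Ideal.comap_map_of_surjective _ hmk, ← RingHom.ker_eq_comap_bot, Ideal.mk_ker]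
  let m' : ι → Ideal C := fun i ↦ (m i).map mk
  have hm'c : ∀ i, (m' i).comap mk = m i := fun i ↦ by rw [hcm, sup_eq_left.mpr (hI i)]
  have hm'mem : ∀ i x, mk x ∈ m' i ↔ x ∈ m i := fun i x ↦ by rw [← Ideal.mem_comap, hm'c]
  have hm'max : ∀ i, (m' i).IsMaximal := fun i ↦
    Ideal.IsMaximal.map_of_surjective_of_ker_le hmk (by rw [Ideal.mk_ker]; exact hI i)
  have hm'int : ∀ i, Algebra.IsIntegral R (C ⧸ m' i) := fun i ↦ by
    have : Module.Finite R (C ⧸ m' i) := by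
      let F : (B ⧸ m i) →ₐ[R] (C ⧸ m' i) := Ideal.quotientMapₐ (m' i) (Ideal.Quotient.mkₐ R I)
        (hm'c i).ge
      refine .of_surjective F.toLinearMap ?_
      exact Ideal.quotientMap_surjective (H := (hm'c i).ge) hmk
    infer_instance
  have hm'inj : Function.Injective m' := fun i j hij ↦ hm (by rw [← hm'c i, hij, hm'c j])
  have : Algebra.FiniteType P C := .of_restrictScalars_finiteType R P C
  have hqf : ∀ i, Algebra.QuasiFiniteAt P (m' i) := by
    intro i
    refine quasiFiniteAt_of_forall_eq (m' i) fun q hq hqm hle ↦ ?_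
    have hq' : q.comap mk = m i := by
      refine hgm i (q.comap mk) inferInstance (sup_le ?_ ?_) ?_ fun l p hp ↦ ?_
      · rw [Ideal.map_le_iff_le_comap]
        intro r hr
        have h1 : (MvPolynomial.C r : P) ∈ (m' i).under P := by
          change mk (aeval g (MvPolynomial.C r)) ∈ m' i
          rw [hm'mem, algHom_C]
          have := (Ideal.LiesOver.over (P := m i) (p := IsLocalRing.maximalIdeal R)).le hr
          exact this
        have h2 := hle h1
        change mk (aeval g (MvPolynomial.C r)) ∈ q at h2
        rwa [algHom_C] at h2
      · intro a ha
        change mk a ∈ q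
        rw [show mk a = 0 from Ideal.Quotient.eq_zero_iff_mem.mpr ha]
        exact q.zero_mem
      · rw [← hm'c i]
        exact Ideal.comap_mono hqm
      · have h0 : aeval (R := R) g (Polynomial.aeval (X l) p) = Polynomial.aeval (g l) p := by
          rw [← Polynomial.aeval_algHom_apply, aeval_X]
        have h1 : (Polynomial.aeval (X l) p : P) ∈ (m' i).under P := by
          change mk (aeval g _) ∈ m' i
          rwa [hm'mem, h0]
        have h2 := hle h1
        change mk (aeval g _) ∈ q at h2
        rwa [h0] at h2
    rw [← Ideal.map_comap_of_surjective mk hmk q, hq']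
  obtain ⟨E, hE, s, hsE, hsm, hs⟩ := exists_finite_subalgebra_forall_pow_mul_mem (P := P) m'
  have hnmax : ∀ i, ((m' i).comap (algebraMap E C)).IsMaximal := fun i ↦
    Ideal.isMaximal_comap_of_isIntegral_quotient (R := R) (IsScalarTower.toAlgHom R E C) (m' i)
  have hwmax : ∀ i, ((m' i).under P).IsMaximal := fun i ↦
    Ideal.isMaximal_comap_of_isIntegral_quotient (R := R) φ (m' i)
  obtain ⟨c, hcE, hcb, hc⟩ := exists_sub_mem_sq_and_forall_mem_of_ne m' hm'inj E hsE hsm hs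
    (mk (b 0))
  obtain ⟨c, rfl⟩ := hmk c
  obtain ⟨s, rfl⟩ := hmk s
  obtain ⟨f₀, hf₀c, hf₀b⟩ := Ideal.exists_sub_mem_and_forall_sub_mem_sq m hm I (b 0) c fun i ↦ by
    have h := hcb i
    rwa [← map_sub, ← Ideal.map_pow, ← Ideal.mem_comap, hcm] at h
  have hf₀ : mk f₀ = mk c := Ideal.Quotient.eq.mpr hf₀c
  let f : Fin (d + 1) → B := Fin.cons f₀ g
  have hfb : ∀ i l, f l - b l ∈ m i ^ 2 := fun i l ↦
    Fin.cases (hf₀b i) (fun l ↦ hg l i) l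
  have hfb' : ∀ i l, f l - b l ∈ m i := fun i l ↦ Ideal.pow_le_self two_ne_zero (hfb i l)
  have hfs : ∀ i, Submodule.span B (Set.range fun l ↦ D R B (f l)) ⊔ m i • ⊤ = ⊤ := fun i ↦
    span_sup_smul_eq_top_of_sub_mem_sq (m i) (hfb i) (hb i).2.1
  refine ⟨f, hfs, ?_⟩
  let E' : Subalgebra R C := E.restrictScalars R
  have hfE : ∀ l, mk (f l) ∈ E' := by
    refine Fin.cases ?_ fun l ↦ ?_
    · change mk f₀ ∈ E
      rwa [hf₀]
    · change mk (g l) ∈ E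
      have h := E.algebraMap_mem (X l)
      rwa [hφ, aeval_X] at h
  let ψ : MvPolynomial (Fin (d + 1)) R →ₐ[R] E' := aeval (fun l ↦ (⟨_, hfE l⟩ : E'))
  have hψ : ∀ p, (ψ p : C) = mk (aeval f p) := by
    intro p
    have h1 : E'.val.comp ψ = (Ideal.Quotient.mkₐ R I).comp (aeval f) := by
      ext l
      simp [ψ, mk, C]
    exact DFunLike.congr_fun h1 p
  have hfren : ∀ p : P, aeval f (rename Fin.succ p) = aeval g p := fun p ↦ by
    rw [aeval_rename]
    rfl
  have hym : ∀ i, ((m i).comap (aeval (R := R) f)).IsMaximal := fun i ↦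
    Ideal.isMaximal_comap_of_isIntegral_quotient (aeval f) (m i)
  have hnmax' : ∀ i, (((m i).map (Ideal.Quotient.mk I)).comap
      (algebraMap E' (B ⧸ I))).IsMaximal := hnmax
  refine exists_mul_sub_mem_of_subalgebra I m f E' hfE ?_ hI hsE
    (fun i h ↦ hsm i ((hm'mem i s).mpr h)) (fun c ↦ ?_) ?_
    (fun i x hx ↦ exists_mul_mem_map_comap_of_span_sup_smul_eq_top (m i) f (hB i) (hfs i) hx) ?_
  · refine RingHom.Finite.of_comp_finite (f := (rename Fin.succ : P →ₐ[R] _).toRingHom) ?_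
    have h1 : (algebraMap P E).Finite := RingHom.finite_algebraMap.mpr hE
    have h2 : ψ.toRingHom.comp (rename Fin.succ : P →ₐ[R] _).toRingHom = algebraMap P E := by
      refine RingHom.ext fun p ↦ Subtype.ext ?_
      change (ψ (rename Fin.succ p) : C) = mk (aeval g p)
      rw [hψ, hfren]
    exact h2 ▸ h1
  · obtain ⟨N, hN⟩ := hs (mk c)
    refine ⟨N, ?_⟩
    rw [map_mul, map_pow]
    exact hN
  · intro i q hq hle
    change ∀ p, aeval f p ∈ m i → ψ p ∈ q at hle
    have hyq : (m i).comap (aeval (R := R) f) = q.comap ψ :=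
      (hym i).eq_of_le (Ideal.comap_ne_top _ hq.ne_top) hle
    obtain ⟨j, rfl⟩ : ∃ j, q = (m' j).comap (algebraMap E' C) := by
      by_contra! hcon
      have hcq := hc q hq.isPrime ⟨i, (hwmax i).eq_of_le (Ideal.comap_ne_top _ hq.ne_top)
        fun p hp ↦ ?_⟩ hcon hcE
      · have h1 : ψ (X 0) ∈ q := by
          have h2 : ψ (X 0) = (⟨mk c, hcE⟩ : E') := by
            refine Subtype.ext ?_
            rw [hψ, aeval_X]
            exact hf₀
          rw [h2]
          exact hcq
        have h2 : aeval f (X 0 : MvPolynomial (Fin (d + 1)) R) ∈ m i := hyq.ge h1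
        rw [aeval_X] at h2
        exact (hb i).2.2.1 ((Submodule.sub_mem_iff_right _ h2).mp (hfb' i 0))
      · have h1 : ψ (rename Fin.succ p) ∈ q := hle _ (by
          rw [hfren, ← hm'mem]
          exact hp)
        have h2 : algebraMap P E p = ψ (rename Fin.succ p) := by
          refine Subtype.ext ?_
          rw [hψ, hfren]
          rfl
        change algebraMap P E p ∈ q
        rw [h2]
        exact h1
    have hij : j = i := by
      by_contra hji
      obtain ⟨Q, hQi, hQj⟩ := (hb i).2.2.2 j hji
      have h0 : aeval (R := R) f (Polynomial.aeval (X 0) Q) = Polynomial.aeval (f 0) Q := by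
        rw [← Polynomial.aeval_algHom_apply, aeval_X]
      have h1 : ψ (Polynomial.aeval (X 0) Q) ∈ (m' j).comap (algebraMap E' C) := hle _ (by
        rw [h0]
        exact (Submodule.sub_mem_iff_left _ hQi).mp
          (Polynomial.aeval_sub_aeval_mem (m i) (hfb' i 0) Q))
      change (ψ _ : C) ∈ m' j at h1
      rw [hψ, h0, hm'mem] at h1
      exact hQj ((Submodule.sub_mem_iff_right _ h1).mp
        (Polynomial.aeval_sub_aeval_mem (m j) (hfb' j 0) Q))
    rw [hij]
  · intro i x
    obtain ⟨p, hp⟩ := (hb i).1 x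
    refine ⟨p, ?_⟩
    rw [← sub_sub_sub_cancel_right _ _ (aeval b p)]
    exact sub_mem hp (MvPolynomial.aeval_sub_aeval_mem _ (hfb' i) p)

end Presentation

section Spreading

variable {P B : Type u} [CommRing P] [CommRing B] [Algebra P B] {ι : Type*} (m : ι → Ideal B)
  (I : Ideal B)

theorem exists_mul_sub_mem_smul {i : ι}
    (hgen : ∀ b, ∃ p₀ p : P, (∀ i, algebraMap P B p₀ ∉ m i) ∧ algebraMap P B p₀ * b -
      algebraMap P B p ∈ I) [∀ i, (m i).IsPrime] {w : B}
    (hw : w ∈ ((m i).under P).map (algebraMap P B)) :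
    ∃ p₀ p : P, (∀ i, algebraMap P B p₀ ∉ m i) ∧ p ∈ (m i).under P ∧
      algebraMap P B p₀ * w - algebraMap P B p ∈ m i * I := by
  induction hw using Submodule.span_induction with
  | mem w hw =>
    obtain ⟨p, hp, rfl⟩ := hw
    exact ⟨1, p, fun i ↦ by simpa using Ideal.IsPrime.one_notMem inferInstance, hp, by simp⟩
  | zero => exact ⟨1, 0, fun i ↦ by simpa using Ideal.IsPrime.one_notMem inferInstance,
      zero_mem _, by simp⟩
  | add w w' _ _ hw hw' =>
    obtain ⟨p₀, p, hp₀, hp, hw⟩ := hw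
    obtain ⟨p₀', p', hp₀', hp', hw'⟩ := hw'
    refine ⟨p₀ * p₀', p₀' * p + p₀ * p', fun i ↦ ?_,
      add_mem (Ideal.mul_mem_left _ _ hp) (Ideal.mul_mem_left _ _ hp'), ?_⟩
    · rw [map_mul]
      exact Ideal.IsPrime.mul_notMem inferInstance (hp₀ i) (hp₀' i)
    · convert add_mem (Ideal.mul_mem_left _ (algebraMap P B p₀') hw)
        (Ideal.mul_mem_left _ (algebraMap P B p₀) hw') using 1
      simp only [map_mul, map_add]
      ring
  | smul b w _ hw =>
    obtain ⟨p₀, p, hp₀, hp, hw⟩ := hw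
    obtain ⟨p₁, p', hp₁, hb⟩ := hgen b
    refine ⟨p₀ * p₁, p' * p, fun i ↦ ?_, Ideal.mul_mem_left _ _ hp, ?_⟩
    · rw [map_mul]
      exact Ideal.IsPrime.mul_notMem inferInstance (hp₀ i) (hp₁ i)
    · have h1 := add_mem (Ideal.mul_mem_left _ (algebraMap P B p₁ * b) hw)
        (Ideal.mul_mem_mul (show algebraMap P B p ∈ m i from hp) hb)
      convert h1 using 1
      simp only [map_mul, smul_eq_mul]
      ring

/-- If `P → B` is unramified at the maximal ideals `m i` and is, near these, surjective modulo `I`,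
then `I` is generated near the `m i` by its contraction to `P`. -/
theorem exists_notMem_forall_mul_mem_map_under (i : ι) [∀ i, (m i).IsMaximal] [IsNoetherianRing B]
    [Algebra.EssFiniteType P B] [Algebra.IsUnramifiedAt P (m i)] (hI : ∀ i, I ≤ m i)
    (hgen : ∀ b, ∃ p₀ p : P, (∀ i, algebraMap P B p₀ ∉ m i) ∧ algebraMap P B p₀ * b -
      algebraMap P B p ∈ I) :
    ∃ u ∉ m i, ∀ x ∈ I, u * x ∈ (I.under P).map (algebraMap P B) := by
  let J := (I.under P).map (algebraMap P B)
  have hJI : J ≤ I := Ideal.map_comap_le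
  have key : I ≤ J ⊔ m i * I := by
    intro x hx
    obtain ⟨s, hs, hsx⟩ := exists_mul_mem_map_under_of_isUnramifiedAt (P := P) (m i) (hI i hx)
    obtain ⟨p₀, p, hp₀, -, hp⟩ := exists_mul_sub_mem_smul m I hgen hsx
    have hpI : algebraMap P B p ∈ I := by
      have h1 : algebraMap P B p₀ * (s * x) - algebraMap P B p ∈ I := Ideal.mul_le_right hp
      exact (Submodule.sub_mem_iff_right _ (I.mul_mem_left _ (I.mul_mem_left s hx))).mp h1
    have h2 : algebraMap P B p₀ * s ∉ m i := Ideal.IsPrime.mul_notMem inferInstance (hp₀ i) hs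
    have hmi : (m i).IsMaximal := inferInstance
    obtain ⟨a, e, he, hae⟩ := hmi.exists_inv h2
    have h3 : x = a * (algebraMap P B p + (algebraMap P B p₀ * (s * x) - algebraMap P B p)) +
        e * x := by linear_combination (-x) * hae
    rw [h3]
    refine add_mem (Ideal.mul_mem_left _ _ (add_mem ?_ ?_)) ?_
    · exact Ideal.mem_sup_left (Ideal.mem_map_of_mem _ hpI)
    · exact Ideal.mem_sup_right hp
    · exact Ideal.mem_sup_right (Ideal.mul_mem_mul he hx)
  have htop : Submodule.comap I.subtype J ⊔ m i • (⊤ : Submodule B I) = ⊤ := by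
    rw [eq_top_iff]
    rintro ⟨x, hx⟩ -
    obtain ⟨y, hy, z, hz, rfl⟩ := Submodule.mem_sup.mp (key hx)
    have hyI := hJI hy
    have hzI : z ∈ I := (Ideal.mul_le_right : m i * I ≤ I) hz
    refine Submodule.mem_sup.mpr ⟨⟨y, hyI⟩, hy, ⟨z, hzI⟩, ?_, rfl⟩
    have h1 : (m i • (⊤ : Submodule B I)).map I.subtype = m i * I := by
      rw [Submodule.map_smul'', Submodule.map_top, Submodule.range_subtype, smul_eq_mul]
    rw [← h1] at hz
    obtain ⟨z', hz', rfl⟩ := hz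
    exact hz'
  obtain ⟨u, hu, hux⟩ :=
    Submodule.exists_sub_one_mem_forall_smul_mem_of_sup_smul_eq_top (m i) _ htop
  refine ⟨u, fun h ↦ ?_, fun x hx ↦ hux ⟨x, hx⟩⟩
  exact Ideal.IsPrime.one_notMem inferInstance ((Submodule.sub_mem_iff_right _ h).mp hu)

theorem exists_etale_localizationAway_and_forall_mul_mem_map_under [Finite ι] [∀ i, (m i).IsMaximal]
    [IsNoetherianRing P] [Algebra.FiniteType P B] [∀ i, Algebra.IsEtaleAt P (m i)]
    (hI : ∀ i, I ≤ m i)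
    (hgen : ∀ b, ∃ p₀ p : P, (∀ i, algebraMap P B p₀ ∉ m i) ∧ algebraMap P B p₀ * b -
      algebraMap P B p ∈ I) :
    ∃ g : B, (∀ i, g ∉ m i) ∧ Algebra.Etale P (Localization.Away g) ∧
      ∀ x ∈ I, g * x ∈ (I.under P).map (algebraMap P B) := by
  have : IsNoetherianRing B := Algebra.FiniteType.isNoetherianRing P B
  have : Algebra.FinitePresentation P B := Algebra.FinitePresentation.of_finiteType.mp inferInstance
  obtain ⟨K, hK⟩ := (PrimeSpectrum.isOpen_iff _).mp (Algebra.isOpen_etaleLocus (R := P) (A := B))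
  let L : Ideal B := ((I.under P).map (algebraMap P B)).colon (I : Set B)
  have hL : ∀ x, x ∈ L ↔ ∀ y ∈ I, x * y ∈ (I.under P).map (algebraMap P B) := fun x ↦ by
    simp [L, Submodule.mem_colon]
  obtain ⟨g, hg, hgm⟩ := Ideal.exists_mem_forall_notMem_of_forall_not_le (Ideal.span K * L) m
    fun i hle ↦ by
      rcases (Ideal.IsPrime.mul_le inferInstance).mp hle with h | h
      · have h1 : (⟨m i, inferInstance⟩ : PrimeSpectrum B) ∈ (Algebra.etaleLocus P B)ᶜ := by
          rw [hK, PrimeSpectrum.mem_zeroLocus]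
          exact Ideal.span_le.mp h
        exact h1 (inferInstance : Algebra.IsEtaleAt P (m i))
      · have hur : Algebra.IsUnramifiedAt P (m i) := inferInstance
        obtain ⟨u, hu, hux⟩ := exists_notMem_forall_mul_mem_map_under m I i hI hgen
        exact hu (h ((hL u).mpr hux))
  have hgL : g ∈ L := Ideal.mul_le_right hg
  refine ⟨g, hgm, ?_, (hL g).mp hgL⟩
  rw [← Algebra.basicOpen_subset_etaleLocus_iff_etale, ← Set.compl_subset_compl, hK,
    ← PrimeSpectrum.zeroLocus_span, PrimeSpectrum.basicOpen_eq_zeroLocus_compl, compl_compl]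
  have hgK : g ∈ Ideal.span K := Ideal.mul_le_left hg
  exact PrimeSpectrum.zeroLocus_anti_mono (Set.singleton_subset_iff.mpr hgK)

end Spreading

section Localization

variable {P B : Type u} [CommRing P] [CommRing B] [Algebra P B]

theorem etale_of_isLocalization_sup_powers (M : Submonoid P) (g : B)
    [Algebra.Etale P (Localization.Away g)] (A T : Type u) [CommRing A] [CommRing T] [Algebra P A]
    [Algebra B T] [Algebra P T] [Algebra A T] [IsScalarTower P A T] [IsScalarTower P B T]
    [IsLocalization M A] [IsLocalization (M.map (algebraMap P B) ⊔ Submonoid.powers g) T] :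
    Algebra.Etale A T := by
  let S := M.map (algebraMap P B) ⊔ Submonoid.powers g
  let Bg := Localization.Away g
  let : Algebra Bg T := (IsLocalization.map T (RingHom.id B)
    (show Submonoid.powers g ≤ S.comap (RingHom.id B) from le_sup_right) : Bg →+* T).toAlgebra
  have : IsScalarTower B Bg T := .of_algebraMap_eq fun x ↦ by
    rw [RingHom.algebraMap_toAlgebra, IsLocalization.map_eq, RingHom.id_apply]
  have : IsScalarTower P Bg T := .to₁₃₄ P B Bg T
  have h1 : IsLocalization (S.map (algebraMap B Bg)) T :=
    IsLocalization.isLocalization_of_submonoid_le Bg T (Submonoid.powers g) S le_sup_right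
  let M' := Algebra.algebraMapSubmonoid Bg M
  have h2 : IsLocalization (S.map (algebraMap B Bg)) (Localization M') := by
    refine IsLocalization.of_le_of_exists_dvd M' _ ?_ ?_
    · rintro _ ⟨p, hp, rfl⟩
      exact ⟨algebraMap P B p, Submonoid.mem_sup_left ⟨p, hp, rfl⟩,
        (IsScalarTower.algebraMap_apply P B Bg p).symm⟩
    · rintro _ ⟨s, hs, rfl⟩
      obtain ⟨_, ⟨p, hp, rfl⟩, _, ⟨k, rfl⟩, rfl⟩ := Submonoid.mem_sup.mp hs
      refine ⟨algebraMap P Bg p, ⟨p, hp, rfl⟩, ?_⟩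
      have hu : IsUnit (algebraMap B Bg (g ^ k)) := by
        rw [map_pow]
        exact (IsLocalization.Away.algebraMap_isUnit g).pow k
      rw [map_mul, ← IsScalarTower.algebraMap_apply]
      exact hu.mul_right_dvd.mpr dvd_rfl
  have h3 : IsLocalization M' T := IsLocalization.isLocalization_of_algEquiv M'
    (IsLocalization.algEquiv (S.map (algebraMap B Bg)) (Localization M') T)
  have h4 : Algebra.IsPushout P A Bg T := (Algebra.isPushout_of_isLocalization M A Bg T).symm
  exact .of_equiv h4.equiv

end Localization

section Height

theorem Ideal.exists_radical_span_singleton_eq_of_height_eq_one {A : Type*} [CommRing A]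
    [IsDomain A] [UniqueFactorizationMonoid A] [IsNoetherianRing A] {J : Ideal A}
    (hJ : J.IsRadical) (h : ∀ q ∈ J.minimalPrimes, q.height = 1) :
    ∃ a : A, (Ideal.span {a}).radical = J := by
  classical
  have hfin := Ideal.finite_minimalPrimes_of_isNoetherianRing A J
  have hprin : ∀ q ∈ J.minimalPrimes, ∃ x, q = Ideal.span {x} := by
    intro q hq
    have := hq.1.1
    have hq0 : q ≠ ⊥ := by
      rintro rfl
      simpa using h _ hq
    obtain ⟨x, hxq, hx⟩ := Ideal.IsPrime.exists_mem_prime_of_ne_bot this hq0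
    exact ⟨x, Ideal.eq_span_singleton_of_height_eq_one (h q hq) hxq hx⟩
  choose! x hx using hprin
  refine ⟨∏ q ∈ hfin.toFinset, x q, le_antisymm ?_ fun a ha ↦ ?_⟩
  · rw [hJ.radical_le_iff, Ideal.span_singleton_le_iff_mem]
    suffices h1 : ∏ q ∈ hfin.toFinset, x q ∈ sInf J.minimalPrimes by
      rwa [Ideal.sInf_minimalPrimes, hJ.radical] at h1
    refine Submodule.mem_sInf.mpr fun q hq ↦ ?_
    refine Ideal.mem_of_dvd _ (Finset.dvd_prod_of_mem x (hfin.mem_toFinset.mpr hq)) ?_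
    rw [hx q hq]
    refine Ideal.mem_span_singleton.mpr ?_
    rw [← hx q hq]
  · refine ⟨hfin.toFinset.card, Ideal.mem_span_singleton.mpr ?_⟩
    rw [← Finset.prod_const]
    refine Finset.prod_dvd_prod_of_dvd _ _ fun q hq ↦ ?_
    rw [Set.Finite.mem_toFinset] at hq
    rw [← Ideal.mem_span_singleton, ← hx q hq]
    exact hq.1.2 ha

theorem Ideal.height_under_eq_of_etale {A T : Type u} [CommRing A] [CommRing T] [Algebra A T]
    [IsNoetherianRing A] [Algebra.Etale A T] (Q : Ideal T) [Q.IsPrime] :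
    (Q.under A).height = Q.height := by
  have : IsNoetherianRing T := Algebra.FiniteType.isNoetherianRing A T
  refine le_antisymm ?_ (Ideal.height_le_height_under_of_quasiFiniteAt Q)
  rw [Ideal.height_eq_height_add_of_liesOver_of_hasGoingDown (Q.under A) Q]
  exact le_self_add

theorem Ideal.minimalPrimes_comap_of_surjective_quotient {A T : Type*} [CommRing A] [CommRing T]
    (φ : A →+* T) (K : Ideal T) (h : ∀ t, ∃ a, t - φ a ∈ K) {q : Ideal A}
    (hq : q ∈ (K.comap φ).minimalPrimes) : ∃ Q ∈ K.minimalPrimes, Q.comap φ = q := by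
  have hsurj : Function.Surjective ((Ideal.Quotient.mk K).comp φ) := by
    intro t
    obtain ⟨t, rfl⟩ := Ideal.Quotient.mk_surjective t
    obtain ⟨a, ha⟩ := h t
    exact ⟨a, (Ideal.Quotient.eq.mpr ha).symm⟩
  have hker : K.comap φ = (⊥ : Ideal (T ⧸ K)).comap ((Ideal.Quotient.mk K).comp φ) := by
    rw [← Ideal.comap_comap, ← RingHom.ker_eq_comap_bot, Ideal.mk_ker]
  rw [hker, Ideal.comap_minimalPrimes_eq_of_surjective hsurj] at hq
  obtain ⟨Q, hQ, rfl⟩ := hq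
  refine ⟨Q.comap (Ideal.Quotient.mk K), ?_, Ideal.comap_comap _ _⟩
  have h2 := Ideal.comap_minimalPrimes_eq_of_surjective (Ideal.Quotient.mk_surjective (I := K))
    (⊥ : Ideal (T ⧸ K))
  rw [← RingHom.ker_eq_comap_bot, Ideal.mk_ker] at h2
  rw [h2]
  exact ⟨Q, hQ, rfl⟩

end Height

section Localization

variable {P B : Type u} [CommRing P] [CommRing B] [Algebra P B]

/-- If `P → B` is étale at the maximal ideals `m i` and is, near these, surjective modulo `I`, then
after localization it identifies `B ⧸ I` with a quotient of `P`, whose ideal is up to radical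
principal when `P` is factorial and `I` has pure height one. -/
theorem exists_localization_etale [IsDomain P] [UniqueFactorizationMonoid P] [IsNoetherianRing P]
    [Algebra.FiniteType P B] {ι : Type*} [Finite ι] (m : ι → Ideal B) [∀ i, (m i).IsMaximal]
    [∀ i, Algebra.IsEtaleAt P (m i)] (I : Ideal B) (hI : ∀ i, I ≤ m i)
    (hgen : ∀ b, ∃ p₀ p : P, (∀ i, algebraMap P B p₀ ∉ m i) ∧ algebraMap P B p₀ * b -
      algebraMap P B p ∈ I)
    (hrad : I.IsRadical) (hht : ∀ q ∈ I.minimalPrimes, q.height = 1) (M : Submonoid P)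
    (hM : ∀ p, p ∈ M ↔ ∀ i, algebraMap P B p ∉ m i) :
    ∃ (S : Submonoid B) (φ : Localization M →+* Localization S), (∀ i, ∀ s ∈ S, s ∉ m i) ∧
      (∀ p, φ (algebraMap P _ p) = algebraMap B _ (algebraMap P B p)) ∧ φ.Etale ∧
      (∀ t, ∃ a, t - φ a ∈ I.map (algebraMap B (Localization S))) ∧
      ((I.map (algebraMap B (Localization S))).comap φ).map φ = I.map (algebraMap B _) ∧
      ∃ h, (Ideal.span {h}).radical = (I.map (algebraMap B (Localization S))).comap φ := by
  have : IsNoetherianRing B := Algebra.FiniteType.isNoetherianRing P B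
  obtain ⟨g, hgm, _, hgI⟩ :=
    exists_etale_localizationAway_and_forall_mul_mem_map_under m I hI hgen
  let S := M.map (algebraMap P B) ⊔ Submonoid.powers g
  let A := Localization M
  let T := Localization S
  have hMS : M ≤ S.comap (algebraMap P B) := fun p hp ↦ Submonoid.mem_sup_left ⟨p, hp, rfl⟩
  let φ : A →+* T := IsLocalization.map T (algebraMap P B) hMS
  have hφ : ∀ p, φ (algebraMap P A p) = algebraMap B T (algebraMap P B p) :=
    fun p ↦ IsLocalization.map_eq hMS p
  let : Algebra A T := φ.toAlgebra
  have : IsScalarTower P A T := .of_algebraMap_eq fun p ↦ by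
    rw [RingHom.algebraMap_toAlgebra, hφ, ← IsScalarTower.algebraMap_apply]
  have : IsLocalization (M.map (algebraMap P B) ⊔ Submonoid.powers g) T :=
    (inferInstance : IsLocalization S (Localization S))
  have hA : IsNoetherianRing A := IsLocalization.isNoetherianRing M A inferInstance
  have : Algebra.Etale A T := etale_of_isLocalization_sup_powers M g A T
  let K := I.map (algebraMap B T)
  have hunit : ∀ s ∈ S, ∃ a : A, algebraMap B T s - φ a ∈ K ∧ IsUnit a := by
    intro s hs
    obtain ⟨_, ⟨p, hp, rfl⟩, _, ⟨k, rfl⟩, rfl⟩ := Submonoid.mem_sup.mp hs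
    obtain ⟨p₀, p₁, hp₀, hp₁⟩ := hgen g
    have hp₀M : p₀ ∈ M := (hM _).mpr hp₀
    have hp₁M : p₁ ∈ M := (hM _).mpr fun i h ↦
      Ideal.IsPrime.mul_notMem inferInstance (hp₀ i) (hgm i)
        ((Submodule.sub_mem_iff_left _ h).mp (hI i hp₁))
    have hu : IsUnit (IsLocalization.mk' A p₁ ⟨p₀, hp₀M⟩) := by
      refine isUnit_of_mul_isUnit_left (y := algebraMap P A p₀) ?_
      rw [IsLocalization.mk'_spec' A p₁ ⟨p₀, hp₀M⟩ |> (mul_comm _ _).trans]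
      exact IsLocalization.map_units A ⟨p₁, hp₁M⟩
    have hK : Ideal.Quotient.mk K (algebraMap B T g) =
        Ideal.Quotient.mk K (φ (IsLocalization.mk' A p₁ ⟨p₀, hp₀M⟩)) := by
      have h1 : IsUnit (Ideal.Quotient.mk K (φ (algebraMap P A p₀))) :=
        ((IsLocalization.map_units A ⟨p₀, hp₀M⟩).map φ).map _
      refine h1.mul_left_cancel ?_
      rw [← map_mul, ← map_mul, ← map_mul, IsLocalization.mk'_spec' A p₁ ⟨p₀, hp₀M⟩, hφ, hφ,
        ← map_mul, Ideal.Quotient.eq, ← map_sub]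
      exact Ideal.mem_map_of_mem _ hp₁
    refine ⟨algebraMap P A p * IsLocalization.mk' A p₁ ⟨p₀, hp₀M⟩ ^ k, ?_,
      (IsLocalization.map_units A ⟨p, hp⟩).mul (hu.pow k)⟩
    rw [← Ideal.Quotient.eq]
    simp only [map_mul, map_pow, hK, hφ]
  have hsurj : ∀ t, ∃ a, t - φ a ∈ K := by
    intro t
    obtain ⟨b, s, rfl⟩ := IsLocalization.exists_mk'_eq S t
    obtain ⟨a, ha, u, rfl⟩ := hunit s s.2
    obtain ⟨p₀, p₁, hp₀, hp₁⟩ := hgen b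
    have hp₀M : p₀ ∈ M := (hM _).mpr hp₀
    refine ⟨↑u⁻¹ * IsLocalization.mk' A p₁ ⟨p₀, hp₀M⟩, ?_⟩
    rw [← Ideal.Quotient.eq] at ha ⊢
    have h1 : IsUnit (Ideal.Quotient.mk K (φ (algebraMap P A p₀))) :=
        ((IsLocalization.map_units A ⟨p₀, hp₀M⟩).map φ).map _
    have h2 : IsUnit (Ideal.Quotient.mk K (φ u)) := (u.isUnit.map φ).map _
    refine (h1.mul h2).mul_left_cancel ?_
    rw [mul_assoc]
    nth_rewrite 1 [← ha]
    rw [← map_mul, ← map_mul, ← map_mul, ← map_mul, ← map_mul, ← map_mul,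
      IsLocalization.mk'_spec' T b s, hφ]
    have h3 : algebraMap P A p₀ * ↑u * (↑u⁻¹ * IsLocalization.mk' A p₁ ⟨p₀, hp₀M⟩) =
        algebraMap P A p₁ := by
      rw [mul_assoc, Units.mul_inv_cancel_left, IsLocalization.mk'_spec' A p₁ ⟨p₀, hp₀M⟩]
    rw [h3, hφ, ← map_mul, Ideal.Quotient.eq, ← map_sub]
    exact Ideal.mem_map_of_mem _ hp₁
  have hKrad : K.IsRadical := by
    rw [Ideal.IsRadical, ← IsLocalization.map_radical S, hrad.radical]
  refine ⟨S, φ, fun i s hs ↦ ?_, hφ, RingHom.etale_algebraMap.mpr this, hsurj, ?_, ?_⟩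
  · obtain ⟨_, ⟨p, hp, rfl⟩, _, ⟨k, rfl⟩, rfl⟩ := Submonoid.mem_sup.mp hs
    exact Ideal.IsPrime.mul_notMem inferInstance ((hM p).mp hp i)
      fun h ↦ hgm i (Ideal.IsPrime.mem_of_pow_mem inferInstance _ h)
  · refine le_antisymm Ideal.map_comap_le (Ideal.map_le_iff_le_comap.mpr fun x hx ↦ ?_)
    have hg : IsUnit (algebraMap B T g) :=
      IsLocalization.map_units T (M := S) ⟨g, Submonoid.mem_sup_right (Submonoid.mem_powers g)⟩
    change algebraMap B T x ∈ (K.comap φ).map φ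
    rw [← Ideal.unit_mul_mem_iff_mem _ hg, ← map_mul]
    have h1 : (I.under P).map (algebraMap P B) ≤ ((K.comap φ).map φ).comap (algebraMap B T) := by
      refine Ideal.map_le_iff_le_comap.mpr fun p hp ↦ ?_
      change algebraMap B T (algebraMap P B p) ∈ (K.comap φ).map φ
      rw [← hφ]
      refine Ideal.mem_map_of_mem _ ?_
      rw [Ideal.mem_comap, hφ]
      exact Ideal.mem_map_of_mem _ hp
    exact h1 (hgI x hx)
  · by_cases h0 : 0 ∈ M
    · have : Subsingleton A := IsLocalization.subsingleton (M := M) h0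
      exact ⟨0, Subsingleton.elim _ _⟩
    have : IsDomain A := IsLocalization.isDomain_localization (le_nonZeroDivisors_of_noZeroDivisors h0)
    refine Ideal.exists_radical_span_singleton_eq_of_height_eq_one (hKrad.comap φ) fun q hq ↦ ?_
    obtain ⟨Q, hQ, rfl⟩ := Ideal.minimalPrimes_comap_of_surjective_quotient φ K hsurj hq
    have := hQ.1.1
    rw [IsLocalization.minimalPrimes_map S] at hQ
    rw [← hht _ hQ, IsLocalization.height_under S]
    exact Ideal.height_under_eq_of_etale (A := A) Q

end Localization

section Presentation

variable {R B : Type u} [CommRing R] [CommRing B] [Algebra R B]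

open MvPolynomial in
/-- The algebraic form of a geometric presentation: the closed subscheme `I` of pure height one is,
near finitely many closed points and after an étale base change from affine space `P`, the preimage
of a closed subscheme of affine space that is up to radical defined by one equation. -/
theorem exists_etale_presentation [IsDomain R] [IsDiscreteValuationRing R] [Algebra.Smooth R B]
    {ι : Type*} [Finite ι] (m : ι → Ideal B) [∀ i, (m i).IsMaximal]
    [∀ i, (m i).LiesOver (IsLocalRing.maximalIdeal R)] (hm : Function.Injective m) {d : ℕ}
    (hB : ∀ i, ∃ t ∉ m i, Algebra.IsStandardSmoothOfRelativeDimension (d + 1) R (Localization.Away t))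
    (hk : Infinite (IsLocalRing.ResidueField R) ∨ Subsingleton ι) (I : Ideal B) (hI : ∀ i, I ≤ m i)
    (hcomp : ∀ q ∈ ((IsLocalRing.maximalIdeal R).map (algebraMap R B)).minimalPrimes, ¬ I ≤ q)
    (hrad : I.IsRadical) (hht : ∀ q ∈ I.minimalPrimes, q.height = 1)
    {P : Type u} [CommRing P] [Algebra R P] (e : MvPolynomial (Fin (d + 1)) R ≃ₐ[R] P) :
    ∃ f : P →ₐ[R] B, (∀ i, ((m i).comap f).IsMaximal) ∧
      ∀ M : Submonoid P, (∀ p, p ∈ M ↔ ∀ i, f p ∉ m i) →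
      ∃ (S : Submonoid B) (φ : Localization M →+* Localization S), (∀ i, ∀ s ∈ S, s ∉ m i) ∧
        (∀ p, φ (algebraMap P _ p) = algebraMap B _ (f p)) ∧ φ.Etale ∧
        (∀ t, ∃ a, t - φ a ∈ I.map (algebraMap B (Localization S))) ∧
        ((I.map (algebraMap B (Localization S))).comap φ).map φ = I.map (algebraMap B _) ∧
        ∃ h, (Ideal.span {h}).radical = (I.map (algebraMap B (Localization S))).comap φ := by
  obtain ⟨b, hb, hgen⟩ := exists_presentation m hm hB hk I hI hcomp
  let f : P →ₐ[R] B := (aeval (R := R) b).comp e.symm.toAlgHom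
  have hfe : ∀ p, f (e p) = aeval b p := fun p ↦ congrArg (aeval b) (e.symm_apply_apply p)
  have hfinite : ∀ i, Module.Finite R (B ⧸ m i) := fun i ↦
    finite_quotient_of_isMaximal_of_liesOver (m i)
  refine ⟨f, fun i ↦ Ideal.isMaximal_comap_of_isIntegral_quotient f (m i), fun M hM ↦ ?_⟩
  have : IsDomain P := e.symm.toMulEquiv.isDomain _
  have : UniqueFactorizationMonoid P := e.toMulEquiv.uniqueFactorizationMonoid inferInstance
  have : IsNoetherianRing P := isNoetherianRing_of_ringEquiv _ e.toRingEquiv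
  let : Algebra P B := f.toRingHom.toAlgebra
  have : IsScalarTower R P B := .of_algebraMap_eq' f.comp_algebraMap.symm
  have : Algebra.FiniteType P B := .of_restrictScalars_finiteType R P B
  have het : ∀ i, Algebra.IsEtaleAt P (m i) := by
    intro i
    obtain ⟨t, ht, _⟩ := hB i
    let : Algebra (MvPolynomial (Fin (d + 1)) R) B := (aeval (R := R) b).toRingHom.toAlgebra
    have : IsScalarTower R (MvPolynomial (Fin (d + 1)) R) B :=
      .of_algebraMap_eq' (aeval b).comp_algebraMap.symm
    have h : ∀ i, algebraMap (MvPolynomial (Fin (d + 1)) R) B (X i) = b i := fun i ↦ aeval_X b i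
    have h1 : Algebra.IsEtaleAt (MvPolynomial (Fin (d + 1)) R) (m i) :=
      isEtaleAt_of_span_sup_smul_eq_top (m i) ht (by simpa only [h] using hb i)
    let : Algebra (MvPolynomial (Fin (d + 1)) R) P := e.toRingEquiv.toRingHom.toAlgebra
    have : IsScalarTower (MvPolynomial (Fin (d + 1)) R) P B := .of_algebraMap_eq fun p ↦ (hfe p).symm
    have : IsScalarTower (MvPolynomial (Fin (d + 1)) R) P (Localization.AtPrime (m i)) :=
      .to₁₂₄ _ P B _
    have : Algebra.FormallyUnramified (MvPolynomial (Fin (d + 1)) R) P :=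
      .of_surjective (Algebra.ofId _ P) e.surjective
    exact Algebra.FormallyEtale.of_restrictScalars (R := MvPolynomial (Fin (d + 1)) R)
  refine exists_localization_etale m I hI (fun x ↦ ?_) hrad hht M hM
  obtain ⟨p₀, p, hp₀, hp⟩ := hgen x
  refine ⟨e p₀, e p, fun i ↦ ?_, ?_⟩
  · change f (e p₀) ∉ m i
    rw [hfe]
    exact hp₀ i
  · change f (e p₀) * x - f (e p) ∈ I
    rw [hfe, hfe]
    exact hp

end Presentation

section Reduced

open GeomPres

theorem GeomPres.exists_iso_red {W A : Scheme.{u}} [IsReduced W] (i : W ⟶ A) [IsClosedImmersion i]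
    (T : Closeds A) (h : Set.range i = T) : ∃ e : W ≅ red T, e.hom ≫ redι T = i := by
  have hT : (redι T).ker = Scheme.IdealSheafData.vanishingIdeal T :=
    Scheme.IdealSheafData.ker_subschemeι _
  have hker : (redι T).ker = i.ker := by
    have h1 := Scheme.IdealSheafData.map_vanishingIdeal i ⊤
    rw [Scheme.IdealSheafData.vanishingIdeal_top, Scheme.nilradical_eq_bot,
      Scheme.IdealSheafData.map_bot] at h1
    rw [h1, hT]
    congr 1
    ext1
    simp [← h, i.isClosedEmbedding.isClosed_range.closure_eq]
  have : IsClosedImmersion (redι T) :=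
    inferInstanceAs (IsClosedImmersion (Scheme.IdealSheafData.subschemeι _))
  have := IsClosedImmersion.isIso_lift (redι T) i hker
  exact ⟨asIso (IsClosedImmersion.lift (redι T) i hker.le), IsClosedImmersion.lift_fac _ _ _⟩

/-- If `A → T ⧸ K` is surjective and `K` is generated by its contraction to `A`, then `Spec T` and
`Spec A` have the same reduced closed subscheme defined by `K`. -/
theorem GeomPres.exists_iso_red_preimage {A T : Type u} [CommRing A] [CommRing T] (φ : A →+* T)
    (K : Ideal T) (hK : K.IsRadical) (hsurj : ∀ t, ∃ a, t - φ a ∈ K)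
    (hmap : (K.comap φ).map φ = K) (Z : Closeds (Spec (.of A)))
    (hZ : (Z : Set (Spec (.of A))) = PrimeSpectrum.zeroLocus (K.comap φ : Set A)) :
    ∃ e : red (Z.preimage (Spec.map (CommRingCat.ofHom φ)).continuous) ≅ red Z,
      e.hom ≫ redι Z = redι (Z.preimage (Spec.map (CommRingCat.ofHom φ)).continuous) ≫
        Spec.map (CommRingCat.ofHom φ) := by
  let j : Spec (.of (T ⧸ K)) ⟶ Spec (.of T) := Spec.map (CommRingCat.ofHom (Ideal.Quotient.mk K))
  have : _root_.IsReduced (T ⧸ K) := (Ideal.isRadical_iff_quotient_reduced K).mp hK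
  have : IsClosedImmersion j := IsClosedImmersion.spec_of_surjective _ Ideal.Quotient.mk_surjective
  have hsurj' : Function.Surjective ((Ideal.Quotient.mk K).comp φ) := fun t ↦ by
    obtain ⟨t, rfl⟩ := Ideal.Quotient.mk_surjective t
    obtain ⟨a, ha⟩ := hsurj t
    exact ⟨a, (Ideal.Quotient.eq.mpr ha).symm⟩
  have hj : j ≫ Spec.map (CommRingCat.ofHom φ) =
      Spec.map (CommRingCat.ofHom ((Ideal.Quotient.mk K).comp φ)) := by
    rw [← Spec.map_comp, ← CommRingCat.ofHom_comp]
  have : IsClosedImmersion (j ≫ Spec.map (CommRingCat.ofHom φ)) := by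
    rw [hj]
    exact IsClosedImmersion.spec_of_surjective _ hsurj'
  obtain ⟨e₁, he₁⟩ := exists_iso_red j (Z.preimage (Spec.map (CommRingCat.ofHom φ)).continuous) (by
    have h1 : Set.range j = PrimeSpectrum.zeroLocus (RingHom.ker (Ideal.Quotient.mk K) : Set T) :=
      range_comap_of_surjective _ _ Ideal.Quotient.mk_surjective
    have h2 : (Spec.map (CommRingCat.ofHom φ)) ⁻¹'
        (PrimeSpectrum.zeroLocus (K.comap φ : Set A) : Set (Spec (.of A))) =
        PrimeSpectrum.zeroLocus (φ '' (K.comap φ)) :=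
      PrimeSpectrum.preimage_comap_zeroLocus φ _
    have h3 : PrimeSpectrum.zeroLocus (φ '' (K.comap φ)) = PrimeSpectrum.zeroLocus (K : Set T) := by
      rw [← PrimeSpectrum.zeroLocus_span]
      exact congrArg (fun J : Ideal T ↦ PrimeSpectrum.zeroLocus (J : Set T)) hmap
    rw [Closeds.coe_preimage, h1, hZ, h2, h3, Ideal.mk_ker])
  obtain ⟨e₂, he₂⟩ := exists_iso_red (j ≫ Spec.map (CommRingCat.ofHom φ)) Z (by
    have h1 : Set.range (Spec.map (CommRingCat.ofHom ((Ideal.Quotient.mk K).comp φ))) =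
        PrimeSpectrum.zeroLocus (RingHom.ker ((Ideal.Quotient.mk K).comp φ) : Set A) :=
      range_comap_of_surjective _ _ hsurj'
    rw [hj, h1, hZ, ← RingHom.comap_ker, Ideal.mk_ker])
  refine ⟨e₁.symm ≪≫ e₂, ?_⟩
  rw [Iso.trans_hom, Category.assoc, he₂, Iso.symm_hom, Iso.inv_comp_eq, ← Category.assoc, he₁]

end Reduced

section Points

open GeomPres

theorem GeomPres.height_eq_one_of_isPureCodim {X B : Type*} [TopologicalSpace X] [QuasiSober X]
    [CommRing B] (π : X ≃ₜ PrimeSpectrum B) (Z : Closeds X) (I : Ideal B)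
    (hI : ∀ p, p ∈ Z ↔ I ≤ (π p).asIdeal) (hZ : IsPureCodim Z 1) :
    ∀ q ∈ I.minimalPrimes, q.height = 1 := by
  intro q hq
  let E₀ : PrimeSpectrum B → (IrreducibleCloseds X)ᵒᵈ := fun q ↦
    OrderDual.toDual ⟨closure {π.symm q}, isIrreducible_singleton.closure, isClosed_closure⟩
  have hE₀ : ∀ q q', E₀ q ≤ E₀ q' ↔ q ≤ q' := by
    intro q q'
    rw [PrimeSpectrum.le_iff_specializes, ← π.symm.isInducing.specializes_iff,
      specializes_iff_closure_subset]
    rfl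
  have hsurj : Function.Surjective E₀ := by
    intro C
    let C' : IrreducibleCloseds X := OrderDual.ofDual C
    obtain ⟨a, ha⟩ := QuasiSober.sober C'.isIrreducible C'.isClosed
    refine ⟨π a, OrderDual.ofDual.injective (IrreducibleCloseds.ext ?_)⟩
    change closure {π.symm (π a)} = (C' : Set X)
    rw [π.symm_apply_apply]
    exact ha
  let E : PrimeSpectrum B ≃o (IrreducibleCloseds X)ᵒᵈ :=
    RelIso.ofSurjective (OrderEmbedding.ofMapLEIff E₀ hE₀) hsurj
  let Q : PrimeSpectrum B := ⟨q, hq.1.1⟩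
  have hQ : Order.coheight (OrderDual.ofDual (E₀ Q)) = 1 := by
    refine hZ _ ⟨?_, fun D hD hle ↦ ?_⟩
    · refine closure_minimal ?_ Z.isClosed
      rw [Set.singleton_subset_iff]
      change π.symm Q ∈ Z
      rw [hI, π.apply_symm_apply]
      exact hq.1.2
    · obtain ⟨q', hq'⟩ := hsurj (OrderDual.toDual D)
      have h1 : q' ≤ Q := (hE₀ q' Q).mp (hq'.trans_le hle)
      have h2 : I ≤ q'.asIdeal := by
        have h3 : π.symm q' ∈ Z := hD (by
          have h4 : D = OrderDual.ofDual (E₀ q') := by rw [hq']; rfl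
          rw [h4]
          exact subset_closure rfl)
        rwa [hI, π.apply_symm_apply] at h3
      have h3 : Q ≤ q' := hq.2 ⟨q'.2, h2⟩ h1
      have h4 : E₀ Q ≤ OrderDual.toDual D := hq' ▸ (hE₀ Q q').mpr h3
      exact h4
  have h1 : Order.height (E Q) = Order.height Q := Order.height_orderIso E Q
  change Q.asIdeal.height = 1
  rw [PrimeSpectrum.height_eq_orderHeight, ← h1]
  exact hQ

theorem GeomPres.not_le_of_mem_minimalPrimes {X Y : Scheme.{u}} (f : X ⟶ Y) (y : Y) {B : Type*}
    [CommRing B] (π : X ≃ₜ PrimeSpectrum B) (Z : Closeds X) (K I : Ideal B)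
    (hK : ∀ p, f p = y ↔ K ≤ (π p).asIdeal) (hI : ∀ p, p ∈ Z ↔ I ≤ (π p).asIdeal)
    (hZ : ∀ C ∈ irreducibleComponents (f.fiber y), ¬ f.fiberι y '' C ⊆ Z) :
    ∀ q ∈ K.minimalPrimes, ¬ I ≤ q := by
  intro q hq hIq
  let Q : PrimeSpectrum B := ⟨q, hq.1.1⟩
  have hp : f (π.symm Q) = y := by
    rw [hK, π.apply_symm_apply]
    exact hq.1.2
  obtain ⟨p, hpQ⟩ : π.symm Q ∈ Set.range (f.fiberι y) := by
    rw [Scheme.Hom.range_fiberι]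
    exact hp
  refine hZ (irreducibleComponent p) (irreducibleComponent_mem_irreducibleComponents p) ?_
  obtain ⟨η, hη⟩ := QuasiSober.sober (isIrreducible_irreducibleComponent (x := p))
    isClosed_irreducibleComponent
  have h1 : η ⤳ p := hη.specializes mem_irreducibleComponent
  have h2 : f.fiberι y η ⤳ π.symm Q := hpQ ▸ h1.map (f.fiberι y).continuous
  have h3 : π (f.fiberι y η) ≤ Q := by
    rw [PrimeSpectrum.le_iff_specializes]
    simpa using h2.map π.continuous
  have h4 : Q ≤ π (f.fiberι y η) := hq.2 ⟨(π (f.fiberι y η)).2, (hK _).mp (by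
    have : f.fiberι y η ∈ Set.range (f.fiberι y) := ⟨η, rfl⟩
    rw [Scheme.Hom.range_fiberι] at this
    exact this)⟩ h3
  have h5 : f.fiberι y η ∈ Z := by
    rw [hI, h3.antisymm h4]
    exact hIq
  rw [← hη.def, Set.image_subset_iff]
  exact closure_minimal (Set.singleton_subset_iff.mpr h5)
    (Z.isClosed.preimage (f.fiberι y).continuous)

end Points

section Affine

open GeomPres

/-- The ring homomorphism corresponding to a morphism from a scheme to an affine scheme. -/
noncomputable def GeomPres.structureHom {X : Scheme.{u}} {R : CommRingCat.{u}} (f : X ⟶ Spec R) :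
    R ⟶ Γ(X, ⊤) :=
  (Scheme.ΓSpecIso R).inv ≫ f.appTop

theorem GeomPres.toSpecΓ_map_structureHom {X : Scheme.{u}} {R : CommRingCat.{u}} (f : X ⟶ Spec R) :
    X.toSpecΓ ≫ Spec.map (structureHom f) = f := by
  rw [structureHom, Spec.map_comp, ← Scheme.toSpecΓ_naturality_assoc, toSpecΓ_SpecMap_ΓSpecIso_inv,
    Category.comp_id]

theorem GeomPres.mem_basicOpen_iff {X : Scheme.{u}} (p : X) (s : Γ(X, ⊤)) :
    p ∈ X.basicOpen s ↔ s ∉ (X.toSpecΓ p).asIdeal := by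
  rw [← Scheme.toSpecΓ_preimage_basicOpen]
  rfl

theorem GeomPres.apply_eq_closedPoint_iff {X : Scheme.{u}} {R : Type u} [CommRing R] [IsLocalRing R]
    (f : X ⟶ Spec (.of R)) (p : X) : f p = IsLocalRing.closedPoint R ↔
      (IsLocalRing.maximalIdeal R).map (structureHom f).hom ≤ (X.toSpecΓ p).asIdeal := by
  have h : f p = PrimeSpectrum.comap (structureHom f).hom (X.toSpecΓ p) := by
    conv_lhs => rw [← toSpecΓ_map_structureHom f]
    rfl
  rw [h, Ideal.map_le_iff_le_comap]
  constructor
  · intro h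
    exact (congrArg PrimeSpectrum.asIdeal h).ge
  · intro h
    exact PrimeSpectrum.ext
      ((IsLocalRing.maximalIdeal.isMaximal R).eq_of_le
        (Ideal.comap_ne_top _ (X.toSpecΓ p).2.ne_top) h).symm

theorem GeomPres.isClosed_singleton_iff_isMaximal {X : Scheme.{u}} [IsAffine X] (p : X) :
    IsClosed ({p} : Set X) ↔ (X.toSpecΓ p).asIdeal.IsMaximal := by
  let π : X ≃ₜ Spec Γ(X, ⊤) := Scheme.homeoOfIso X.isoSpec
  have h : π '' {p} = {X.toSpecΓ p} := Set.image_singleton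
  rw [← π.isClosed_image, h]
  exact PrimeSpectrum.isClosed_singleton_iff_isMaximal _

theorem GeomPres.smooth_structureHom {X : Scheme.{u}} [IsAffine X] {R : CommRingCat.{u}} (n : ℕ)
    (f : X ⟶ Spec R) [hf : SmoothOfRelativeDimension n f] : (structureHom f).hom.Smooth ∧
      RingHom.Locally (RingHom.IsStandardSmoothOfRelativeDimension n) (structureHom f).hom := by
  have h0 : Smooth f := SmoothOfRelativeDimension.smooth n f
  have h1 := (HasRingHomProperty.isLocal_ringHomProperty @Smooth).respectsIso
  have h2 := (HasRingHomProperty.isLocal_ringHomProperty (@SmoothOfRelativeDimension n)).respectsIso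
  rw [structureHom, CommRingCat.hom_comp, h1.cancel_left_isIso, h2.cancel_left_isIso]
  exact ⟨HasRingHomProperty.appTop _ f h0, HasRingHomProperty.appTop _ f hf⟩

/-- The ring of functions on affine space. -/
noncomputable def GeomPres.mvPolynomialEquiv (R : Type u) [CommRing R] (n : ℕ) :
    MvPolynomial (Fin n) R ≃+* Γ(affSpace R n, ⊤) :=
  (MvPolynomial.renameEquiv R Equiv.ulift.symm).toRingEquiv.trans
    ((Scheme.ΓSpecIso (.of (MvPolynomial (ULift.{u} (Fin n)) R))).symm ≪≫
      (Scheme.Γ.mapIso (AffineSpace.SpecIso (ULift.{u} (Fin n)) (.of R)).op)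
      ).commRingCatIsoToRingEquiv

theorem GeomPres.mvPolynomialEquiv_C (R : Type u) [CommRing R] (n : ℕ) (r : R) :
    mvPolynomialEquiv R n (.C r) = structureHom (affSpaceMap R n) r := by
  have h : (Scheme.ΓSpecIso (.of (MvPolynomial (ULift.{u} (Fin n)) R))).inv ≫
      (AffineSpace.SpecIso (ULift.{u} (Fin n)) (.of R)).hom.appTop =
      CommRingCat.ofHom (MvPolynomial.eval₂Hom (structureHom (affSpaceMap R n)).hom
        (AffineSpace.coord _)) := by
    rw [AffineSpace.SpecIso_hom_appTop, Iso.inv_hom_id_assoc]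
    rfl
  have h1 := congrArg (fun φ ↦ φ.hom (MvPolynomial.C r)) h
  simp only [CommRingCat.hom_ofHom, MvPolynomial.eval₂Hom_C] at h1
  rw [← h1]
  simp [mvPolynomialEquiv]
  rfl

end Affine

section Main

open GeomPres

theorem GeomPres.exists_isPullback_morphismRestrict {X Y : Scheme.{u}} (f : X ⟶ Y) (U : Y.Opens)
    (V : X.Opens) (h : V = f ⁻¹ᵁ U) : ∃ t : V.toScheme ⟶ U.toScheme, IsPullback V.ι t f U.ι := by
  subst h
  exact ⟨f ∣_ U, (isPullback_morphismRestrict f U).flip⟩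

theorem GeomPres.locMap_toSpecΓ (X : Scheme.{u}) [IsAffine X] (S : Submonoid Γ(X, ⊤)) :
    locMap X S ≫ X.toSpecΓ =
      Spec.map (CommRingCat.ofHom (algebraMap Γ(X, ⊤) (Localization S))) :=
  (Category.assoc _ _ _).trans ((congrArg (fun g ↦ Spec.map _ ≫ g)
    (Scheme.isoSpec_inv_toSpecΓ X)).trans (Category.comp_id _))

theorem GeomPres.toSpecΓ_locMap_apply (X : Scheme.{u}) [IsAffine X] (S : Submonoid Γ(X, ⊤))
    (t : loc X S) : X.toSpecΓ (locMap X S t) =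
      PrimeSpectrum.comap (algebraMap Γ(X, ⊤) (Localization S)) t :=
  congrArg (fun g : loc X S ⟶ _ ↦ g t) (locMap_toSpecΓ X S)

theorem GeomPres.mem_range_locMap {X : Scheme.{u}} [IsAffine X] {S : Submonoid Γ(X, ⊤)} {p : X}
    (h : ∀ s ∈ S, s ∉ (X.toSpecΓ p).asIdeal) : p ∈ Set.range (locMap X S) := by
  have h1 : X.toSpecΓ p ∈ Set.range (PrimeSpectrum.comap (algebraMap Γ(X, ⊤) (Localization S))) := by
    rw [PrimeSpectrum.localization_comap_range _ S]
    exact Set.disjoint_left.mpr h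
  obtain ⟨t, ht⟩ := h1
  refine ⟨t, (Scheme.homeoOfIso X.isoSpec).injective ?_⟩
  exact (toSpecΓ_locMap_apply X S t).trans ht

theorem PrimeSpectrum.comap_image_zeroLocus_of_surjective {A T : Type*} [CommRing A] [CommRing T]
    (φ : A →+* T) (K : Ideal T) (hsurj : ∀ t, ∃ a, t - φ a ∈ K) :
    PrimeSpectrum.comap φ '' PrimeSpectrum.zeroLocus (K : Set T) =
      PrimeSpectrum.zeroLocus (K.comap φ : Set A) := by
  have hsurj' : Function.Surjective ((Ideal.Quotient.mk K).comp φ) := fun t ↦ by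
    obtain ⟨t, rfl⟩ := Ideal.Quotient.mk_surjective t
    obtain ⟨a, ha⟩ := hsurj t
    exact ⟨a, (Ideal.Quotient.eq.mpr ha).symm⟩
  have h1 := range_comap_of_surjective _ _ hsurj'
  have h2 := range_comap_of_surjective _ _ (Ideal.Quotient.mk_surjective (I := K))
  rw [← RingHom.comap_ker, Ideal.mk_ker] at h1
  rw [Ideal.mk_ker] at h2
  rw [← h1, ← h2, ← Set.range_comp]
  rfl

end Main

theorem theoremA1 (R : Type u) [CommRing R] [IsDomain R] [IsDiscreteValuationRing R]
    (n : ℕ) (hn : 1 ≤ n)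
    (X : Scheme.{u}) [IsAffine X] [IrreducibleSpace X]
    (f : X ⟶ Spec (CommRingCat.of R)) [SmoothOfRelativeDimension n f]
    (Z : Closeds X) (hZ : GeomPres.IsPureCodim Z 1)
    (hZv : ∀ C ∈ irreducibleComponents (f.fiber (IsLocalRing.closedPoint R)),
      ¬ f.fiberι (IsLocalRing.closedPoint R) '' C ⊆ Z)
    (x : Set X) (hxfin : x.Finite)
    (hx : ∀ p ∈ x, p ∈ Z ∧ f p = IsLocalRing.closedPoint R ∧ IsClosed ({p} : Set X))
    (hk : Infinite (IsLocalRing.ResidueField R) ∨ ∃ p : X, x = {p}) :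
    ∃ (S : Submonoid Γ(X, ⊤)) (y : Set (GeomPres.affSpace R n))
      (τ : GeomPres.loc X S ⟶ GeomPres.locAt (GeomPres.affSpace R n) y)
      (h : Γ(GeomPres.locAt (GeomPres.affSpace R n) y, ⊤))
      (t : ((GeomPres.loc X S).basicOpen (τ.appTop h)).toScheme ⟶
        ((GeomPres.locAt (GeomPres.affSpace R n) y).basicOpen h).toScheme),
      -- `y` is a finite set of closed points of the closed fiber of affine space
      y.Finite ∧
      (∀ q ∈ y, GeomPres.affSpaceMap R n q = IsLocalRing.closedPoint R ∧
        IsClosed ({q} : Set (GeomPres.affSpace R n))) ∧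
      -- `τ` is a morphism over `Spec R`
      τ ≫ GeomPres.locAtMap (GeomPres.affSpace R n) y ≫ GeomPres.affSpaceMap R n =
        GeomPres.locMap X S ≫ f ∧
      -- the localization of `X` contains `x`, and `τ` maps `x` onto `y`
      x ⊆ Set.range (GeomPres.locMap X S) ∧
      (τ ≫ GeomPres.locAtMap (GeomPres.affSpace R n) y) '' (GeomPres.locMap X S ⁻¹' x) = y ∧
      -- the complement of `Z` is the locus where `τ^* h` is invertible
      ((GeomPres.loc X S).basicOpen (τ.appTop h) : Set (GeomPres.loc X S)) =
        (GeomPres.locMap X S ⁻¹' Z)ᶜ ∧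
      -- the complement of `τ(Z)` is the locus where `h` is invertible
      ((GeomPres.locAt (GeomPres.affSpace R n) y).basicOpen h :
          Set (GeomPres.locAt (GeomPres.affSpace R n) y)) =
        (τ '' (GeomPres.locMap X S ⁻¹' Z))ᶜ ∧
      GeomPres.IsElementaryDistinguishedSquare
        ((GeomPres.loc X S).basicOpen (τ.appTop h)).ι t τ
        ((GeomPres.locAt (GeomPres.affSpace R n) y).basicOpen h).ι := by
  obtain ⟨d, rfl⟩ : ∃ d, n = d + 1 := ⟨n - 1, by omega⟩
  have : Finite x := hxfin
  let π : X ≃ₜ PrimeSpectrum Γ(X, ⊤) := Scheme.homeoOfIso X.isoSpec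
  let I : Ideal Γ(X, ⊤) := PrimeSpectrum.vanishingIdeal (π.symm ⁻¹' Z)
  have hI : ∀ p, p ∈ Z ↔ I ≤ (X.toSpecΓ p).asIdeal := by
    intro p
    have h1 : PrimeSpectrum.zeroLocus (I : Set Γ(X, ⊤)) = π.symm ⁻¹' Z := by
      rw [PrimeSpectrum.zeroLocus_vanishingIdeal_eq_closure,
        (Z.isClosed.preimage π.symm.continuous).closure_eq]
    have h2 : π p ∈ PrimeSpectrum.zeroLocus (I : Set Γ(X, ⊤)) ↔ p ∈ Z := by
      rw [h1, Set.mem_preimage, π.symm_apply_apply]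
      rfl
    exact h2.symm
  have hIrad : I.IsRadical := PrimeSpectrum.isRadical_vanishingIdeal _
  have hht : ∀ q ∈ I.minimalPrimes, q.height = 1 :=
    GeomPres.height_eq_one_of_isPureCodim π Z I hI hZ
  let ψ : R →+* Γ(X, ⊤) := (GeomPres.structureHom f).hom
  have hcomp : ∀ q ∈ ((IsLocalRing.maximalIdeal R).map ψ).minimalPrimes, ¬ I ≤ q :=
    GeomPres.not_le_of_mem_minimalPrimes f (IsLocalRing.closedPoint R) π Z _ I
      (GeomPres.apply_eq_closedPoint_iff f) hI hZv
  let : Algebra R Γ(X, ⊤) := ψ.toAlgebra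
  let : Algebra R Γ(GeomPres.affSpace R (d + 1), ⊤) :=
    (GeomPres.structureHom (GeomPres.affSpaceMap R (d + 1))).hom.toAlgebra
  let e : MvPolynomial (Fin (d + 1)) R ≃ₐ[R] Γ(GeomPres.affSpace R (d + 1), ⊤) :=
    AlgEquiv.ofRingEquiv (f := GeomPres.mvPolynomialEquiv R (d + 1))
      (GeomPres.mvPolynomialEquiv_C R (d + 1))
  obtain ⟨hsm, s, hs, hsB⟩ := GeomPres.smooth_structureHom (d + 1) f
  have hsm' : Algebra.Smooth R Γ(X, ⊤) := hsm
  let m : x → Ideal Γ(X, ⊤) := fun p ↦ (X.toSpecΓ p).asIdeal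
  have hm : Function.Injective m := fun p q hpq ↦
    Subtype.ext (π.injective (PrimeSpectrum.ext hpq))
  have hmmax : ∀ p, (m p).IsMaximal := fun p ↦
    (GeomPres.isClosed_singleton_iff_isMaximal p.1).mp (hx p.1 p.2).2.2
  have hmR : ∀ p, (m p).LiesOver (IsLocalRing.maximalIdeal R) := fun p ↦
    ⟨(IsLocalRing.maximalIdeal.isMaximal R).eq_of_le (Ideal.comap_ne_top _ (hmmax p).ne_top)
      (Ideal.map_le_iff_le_comap.mp
        ((GeomPres.apply_eq_closedPoint_iff f p.1).mp (hx p.1 p.2).2.1))⟩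
  have hB : ∀ p, ∃ t ∉ m p,
      Algebra.IsStandardSmoothOfRelativeDimension (d + 1) R (Localization.Away t) := by
    intro p
    obtain ⟨t, hts, htm⟩ : ∃ t ∈ s, t ∉ m p := by
      by_contra! hcon
      exact (hmmax p).ne_top (top_le_iff.mp (hs.ge.trans (Ideal.span_le.mpr hcon)))
    refine ⟨t, htm, ?_⟩
    rw [← RingHom.isStandardSmoothOfRelativeDimension_algebraMap,
      IsScalarTower.algebraMap_eq R Γ(X, ⊤) (Localization.Away t)]
    exact hsB t hts
  obtain ⟨g, hgmax, hg⟩ := exists_etale_presentation m hm hB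
    (hk.imp_right fun ⟨p, hp⟩ ↦ by subst hp; infer_instance) I
    (fun p ↦ (hI p.1).mp (hx p.1 p.2).1) hcomp hIrad hht e
  let G : Spec Γ(X, ⊤) ⟶ Spec Γ(GeomPres.affSpace R (d + 1), ⊤) :=
    Spec.map (CommRingCat.ofHom g.toRingHom)
  let F : X ⟶ GeomPres.affSpace R (d + 1) :=
    X.toSpecΓ ≫ G ≫ (GeomPres.affSpace R (d + 1)).isoSpec.inv
  have hFπ : F ≫ (GeomPres.affSpace R (d + 1)).toSpecΓ = X.toSpecΓ ≫ G := by
    simp only [F, Category.assoc, Scheme.isoSpec_inv_toSpecΓ, Category.comp_id]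
  have hFp : ∀ p, ((GeomPres.affSpace R (d + 1)).toSpecΓ (F p)).asIdeal =
      (X.toSpecΓ p).asIdeal.comap g := fun p ↦
    congrArg (fun φ : X ⟶ Spec Γ(GeomPres.affSpace R (d + 1), ⊤) ↦ (φ p).asIdeal) hFπ
  have hFf : F ≫ GeomPres.affSpaceMap R (d + 1) = f := by
    rw [← GeomPres.toSpecΓ_map_structureHom (GeomPres.affSpaceMap R (d + 1)), reassoc_of% hFπ,
      show G = Spec.map (CommRingCat.ofHom g.toRingHom) from rfl, ← Spec.map_comp]
    have h1 : GeomPres.structureHom (GeomPres.affSpaceMap R (d + 1)) ≫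
        CommRingCat.ofHom g.toRingHom = GeomPres.structureHom f :=
      CommRingCat.hom_ext g.comp_algebraMap
    rw [h1, GeomPres.toSpecΓ_map_structureHom]
  let y : Set (GeomPres.affSpace R (d + 1)) := F '' x
  let M := GeomPres.nonvanishing (GeomPres.affSpace R (d + 1)) y
  obtain ⟨S, φ, hSm, hφ, hφet, hsurj, hmap, h, hh⟩ := hg M (fun p ↦ by
    have h1 : p ∈ M ↔ ∀ q ∈ y, q ∈ (GeomPres.affSpace R (d + 1)).basicOpen p := Iff.rfl
    rw [h1]
    simp only [y, Set.forall_mem_image, GeomPres.mem_basicOpen_iff, hFp, Subtype.forall, m]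
    rfl)
  let K : Ideal (Localization S) := I.map (algebraMap Γ(X, ⊤) (Localization S))
  have hK : K.IsRadical := by
    rw [Ideal.IsRadical, ← IsLocalization.map_radical S, hIrad.radical]
  let τ : GeomPres.loc X S ⟶ GeomPres.locAt (GeomPres.affSpace R (d + 1)) y :=
    Spec.map (CommRingCat.ofHom φ)
  let h' : Γ(GeomPres.locAt (GeomPres.affSpace R (d + 1)) y, ⊤) :=
    (Scheme.ΓSpecIso (.of (Localization M))).inv h
  have hτF : τ ≫ GeomPres.locAtMap (GeomPres.affSpace R (d + 1)) y = GeomPres.locMap X S ≫ F := by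
    rw [← cancel_mono (GeomPres.affSpace R (d + 1)).toSpecΓ, Category.assoc, Category.assoc, hFπ,
      GeomPres.locMap_toSpecΓ, reassoc_of% GeomPres.locMap_toSpecΓ X S]
    refine (Spec.map_comp _ _).symm.trans (Eq.trans ?_ (Spec.map_comp _ _))
    congr 1
    exact CommRingCat.hom_ext (RingHom.ext hφ)
  have hlocZ : GeomPres.locMap X S ⁻¹' Z = PrimeSpectrum.zeroLocus (K : Set (Localization S)) := by
    ext t
    refine (hI _).trans ?_
    rw [GeomPres.toSpecΓ_locMap_apply]
    exact Ideal.map_le_iff_le_comap.symm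
  have himage : τ '' (GeomPres.locMap X S ⁻¹' Z) =
      PrimeSpectrum.zeroLocus (K.comap φ : Set (Localization M)) := by
    rw [hlocZ]
    exact PrimeSpectrum.comap_image_zeroLocus_of_surjective φ K hsurj
  have hbasic : ((GeomPres.locAt (GeomPres.affSpace R (d + 1)) y).basicOpen h' : Set _) =
      (τ '' (GeomPres.locMap X S ⁻¹' Z))ᶜ := by
    have h1 : (GeomPres.locAt (GeomPres.affSpace R (d + 1)) y).basicOpen h' =
        PrimeSpectrum.basicOpen h := basicOpen_eq_of_affine _
    have h2 : (PrimeSpectrum.basicOpen h : Set (PrimeSpectrum (Localization M))) =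
        (PrimeSpectrum.zeroLocus (K.comap φ : Set (Localization M)))ᶜ := by
      rw [PrimeSpectrum.basicOpen_eq_zeroLocus_compl, ← PrimeSpectrum.zeroLocus_span,
        ← PrimeSpectrum.zeroLocus_radical, hh]
    rw [h1, himage]
    exact h2
  have hpre : (GeomPres.loc X S).basicOpen (τ.appTop h') =
      τ ⁻¹ᵁ (GeomPres.locAt (GeomPres.affSpace R (d + 1)) y).basicOpen h' :=
    (Scheme.preimage_basicOpen_top τ h').symm
  have hpreZ : τ ⁻¹' (τ '' (GeomPres.locMap X S ⁻¹' Z)) = GeomPres.locMap X S ⁻¹' Z := by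
    rw [himage, hlocZ]
    refine (PrimeSpectrum.preimage_comap_zeroLocus φ _).trans ?_
    rw [← PrimeSpectrum.zeroLocus_span]
    exact congrArg (fun J : Ideal (Localization S) ↦
      PrimeSpectrum.zeroLocus (J : Set (Localization S))) hmap
  have hxrange : x ⊆ Set.range (GeomPres.locMap X S) := fun p hp ↦
    GeomPres.mem_range_locMap (hSm ⟨p, hp⟩)
  obtain ⟨t, ht⟩ := GeomPres.exists_isPullback_morphismRestrict τ _ _ hpre
  refine ⟨S, y, τ, h', t, hxfin.image F, ?_, ?_, hxrange, ?_, ?_, hbasic, ht, inferInstance,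
    (HasRingHomProperty.Spec_iff (P := @Etale)).mpr hφet, fun W hW ↦ ?_⟩
  · rintro _ ⟨p, hp, rfl⟩
    refine ⟨?_, ?_⟩
    · rw [← Scheme.Hom.comp_apply, hFf]
      exact (hx p hp).2.1
    · rw [GeomPres.isClosed_singleton_iff_isMaximal, hFp]
      exact hgmax ⟨p, hp⟩
  · rw [reassoc_of% hτF, hFf]
  · rw [hτF, Scheme.Hom.comp_base, TopCat.coe_comp, Set.image_comp,
      Set.image_preimage_eq_of_subset hxrange]
  · rw [hpre, Scheme.Hom.coe_preimage, hbasic, Set.preimage_compl, hpreZ]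
  · refine GeomPres.exists_iso_red_preimage φ K hK hsurj hmap W ?_
    exact hW.trans (by rw [Scheme.Opens.range_ι, hbasic, compl_compl, himage])
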